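/- Let $A$ be a finite alphabet, $M$ a finite monoid, $\mu : A^*\to M$ a surjective monoid morphism and $k \ge 1$. **Marble bimachines.** A $1$-marble bimachine is given by a function $\lambda : M\times A\times M\to\mathbb N$. A $(k{+}1)$-marble bimachine is given by a finite family $\mathfrak H$ of $k$-marble bimachines (over the same $\mu$) and a function $\lambda : M\times A\times M\to\mathfrak H$. For $w\in A^*$ and positions $i_1\le\dots\le i_k$ of $w$, put $h:=\lambda(\mu(w[1{:}i_k{-}1]),w[i_k],\mu(w[i_k{+}1{:}|w|]))$; the production $\mathrm{prod}^w_{\mathcal M}(\{\!\{i_1,\dots,i_k\}\!\})$ is $h$ if $k=1$, and $\mathrm{prod}^{w[1:i_k]}_{h}(\{\!\{i_1,\dots,i_{k-1}\}\!\})$ if $k\ge 2$. For sets of positions, $\mathrm{prod}^w_{\mathcal M}(\{\!\{I_1,\dots,I_k\}\!\})$ is the sum of $\mathrm{prod}^w_{\mathcal M}(\{\!\{i_1,\dots,i_k\}\!\})$ over all multisets $\{\!\{i_1,\dots,i_k\}\!\}$ with $i_j\in I_j$. **Multicontexts and iterators.** An $x$-multicontext is a sequence $m_0[\![u_1]\!]m_1\cdots[\![u_x]\!]m_x$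 with $m_i\in M$, $u_i\in A^*$; multicontexts are concatenated by multiplying the two elements of $M$ that meet. For a $k$-multicontext, $\mathrm{prod}_{\mathcal M}(m_0[\![u_1]\!]m_1\cdots[\![u_k]\!]m_k):=\mathrm{prod}^w_{\mathcal M}(\{\!\{I_1,\dots,I_k\}\!\})$, where $w=v_0u_1v_1\cdots u_kv_k$ with $\mu(v_i)=m_i$ and $I_i$ is the set of positions of $u_i$ in $w$ (the value does not depend on the $v_i$). An $(x,K)$-iterator is an $x$-multicontext of the form $m_0\prod_{i=1}^x e_i[\![u_i]\!]e_im_i$ with $e_i=\mu(u_i)$ idempotent and $|u_i|\le K$. **Permutability.** $\mathcal M$ is $K$-permutable if for all $\ell+x+r=k$ with $x\ge1$, all $(\ell,K)$-iterators $\mathcal L$ and $(r,K)$-iterators $\mathcal R$, all $(x,K)$-iterators $m_0\prod_{i=1}^x e_i[\![u_i]\!]e_im_i$ such that $e:=m_0\prod_{i=1}^x e_im_i$ is idempotent and all permutations $\sigma$ of $\{1,\dots,x\}$, $$\mathrm{prod}_{\mathcal M}\Big(\mathcal L\, e\,m_0\prod_{i=1}^x e_i[\![u_i]\!]e_im_i\;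 e\,\mathcal R\Big)=\mathrm{prod}_{\mathcal M}\Big(\mathcal L\prod_{i=1}^x \mathrm{left}_{\sigma(i)}[\![u_{\sigma(i)}]\!]\mathrm{right}_{\sigma(i)}\,\mathcal R\Big),$$ where $\mathrm{left}_j:=e\prod_{i=1}^j m_{i-1}e_i$ and $\mathrm{right}_j:=\big(\prod_{i=j}^x e_im_i\big)e$. **Forests.** A factorization forest $\mathcal F$ of $w\in A^*$ is $a$ if $w=a\in A$, or $\varepsilon$ if $w=\varepsilon$, or $\langle\mathcal F_1\rangle\cdots\langle\mathcal F_n\rangle$ with $n\ge1$, where $w=w_1\cdots w_n$, each $\mathcal F_i$ is a factorization forest of the nonempty word $w_i$ and, if $n\ge3$, $\mu(w_1)=\dots=\mu(w_n)$ is idempotent; put $\mu(\mathcal F):=\mu(w)$. The forests $a$ and $\varepsilon$ have height $0$. The nodes of $\mathcal F$ are its root and the nodes of its children $\mathcal F_i$. A node is iterable if it is neither the first nor the last child of its parent. The frontier $\mathrm{Fr}_{\mathcal F}(\mathfrak t)$ of a node $\mathfrak t$ is the set of positions of $w$ whose leaf is reached from $\mathfrak t$ by always moving to the first or to the last child. Let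 $\mathrm{Ind}^x(\mathcal F)$ be the set of sets $\mathfrak T$ of $x$ iterable nodes such that, for all distinct $\mathfrak t,\mathfrak t'\in\mathfrak T$, $\mathfrak t$ is neither an ancestor of $\mathfrak t'$ nor the immediate left or right sibling of an ancestor of $\mathfrak t'$ (a node is an ancestor of itself). **Linearization and architecture.** For $\mathfrak T$ independent or $\mathfrak T=\{\mathcal F\}$: $\mathrm{lin}_{\mathcal F}(\varnothing):=\mu(\mathcal F)$, $\mathrm{lin}_{\mathcal F}(\{\mathcal F\}):=[\![w[\mathrm{Fr}_{\mathcal F}(\mathcal F)]]\!]$, and otherwise $\mathrm{lin}_{\mathcal F}(\mathfrak T):=\mathrm{lin}_{\mathcal F_1}(\mathfrak T_1)\cdots\mathrm{lin}_{\mathcal F_n}(\mathfrak T_n)$, where $\mathcal F=\langle\mathcal F_1\rangle\cdots\langle\mathcal F_n\rangle$ and $\mathfrak T_j$ is the set of nodes of $\mathfrak T$ in $\mathcal F_j$. The architecture $\mathrm{arch}_{\mathcal F}(\mathfrak T)$ of an independent $\mathfrak T$ is $a$ if $\mathcal F=a$ and $\varepsilon$ if $\mathcal F=\varepsilon$; for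 $\mathcal F=\langle\mathcal F_1\rangle\cdots\langle\mathcal F_n\rangle$, $n\ge1$, it is $\langle\mu(\mathcal F)\rangle$ if $\mathfrak T=\varnothing$; otherwise $\langle\mathrm{arch}_{\mathcal F_1}(\mathfrak T_1)\rangle\,\mathrm{arch}_{\langle\mathcal F_2\rangle\cdots\langle\mathcal F_n\rangle}(\mathfrak T\smallsetminus\mathfrak T_1)$ if $\mathfrak T_1\ne\varnothing$; otherwise $\mathrm{arch}_{\langle\mathcal F_1\rangle\cdots\langle\mathcal F_{n-1}\rangle}(\mathfrak T\smallsetminus\mathfrak T_n)\,\langle\mathrm{arch}_{\mathcal F_n}(\mathfrak T_n)\rangle$ if $\mathfrak T_n\ne\varnothing$; otherwise $\langle\{\!\{(\mathrm{lin}_{\mathcal F}(\{\mathfrak t\}),\mathrm{depth}_{\mathcal F}(\mathfrak t)):\mathfrak t\in\mathfrak T\}\!\}\rangle$. **Statement.** Let $\mathcal M$ be a $2^{3|M|}$-permutable $k$-marble bimachine. Let $w,w'\in A^*$ and let $\mathcal F,\mathcal F'$ be factorization forests of $w,w'$ of height at most $3|M|$. 1. Let $\ell+x+r=k$, $\mathfrak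 T\in\mathrm{Ind}^x(\mathcal F)$ and $\mathfrak T'\in\mathrm{Ind}^x(\mathcal F')$ with $\mathrm{arch}_{\mathcal F}(\mathfrak T)=\mathrm{arch}_{\mathcal F'}(\mathfrak T')$. Then for every $(\ell,2^{3|M|})$-iterator $\mathcal L$ and every $(r,2^{3|M|})$-iterator $\mathcal R$, $$\mathrm{prod}_{\mathcal M}(\mathcal L\,\mathrm{lin}_{\mathcal F}(\mathfrak T)\,\mathcal R)=\mathrm{prod}_{\mathcal M}(\mathcal L\,\mathrm{lin}_{\mathcal F'}(\mathfrak T')\,\mathcal R).$$ 2. If $\mathfrak T=\{\mathfrak t_1,\dots,\mathfrak t_k\}\in\mathrm{Ind}^k(\mathcal F)$ and $\mathfrak T'=\{\mathfrak t'_1,\dots,\mathfrak t'_k\}\in\mathrm{Ind}^k(\mathcal F')$ satisfy $\mathrm{arch}_{\mathcal F}(\mathfrak T)=\mathrm{arch}_{\mathcal F'}(\mathfrak T')$, then $$\mathrm{prod}^w_{\mathcal M}(\{\!\{\mathrm{Fr}_{\mathcal F}(\mathfrak t_1),\dots,\mathrm{Fr}_{\mathcal F}(\mathfrak t_k)\}\!\})=\mathrm{prod}^{w'}_{\mathcal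 M}(\{\!\{\mathrm{Fr}_{\mathcal F'}(\mathfrak t'_1),\dots,\mathrm{Fr}_{\mathcal F'}(\mathfrak t'_k)\}\!\}).$$ -/

import Mathlib

noncomputable section

namespace MarbleArch

universe u v

/-- The value in `M` of a word, under a monoid morphism defined on `A*`. -/
def val {A : Type u} {M : Type v} [Monoid M] (μ : FreeMonoid A →* M) (w : List A) : M :=
  μ (FreeMonoid.ofList w)

/-! ### Marble bimachines and their productions -/

/-- `k`-marble bimachines with input alphabet `A`, relative to a morphism `μ : A* → M` which is
shared by all the submachines (and is passed separately).
For `k = 1` the machine is given by an output function `M × A × M → ℕ`; for `k ≥ 1`, a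
`(k+1)`-marble bimachine has a finite set (indexed by `Fin n`) of external functions, each one computed by a
`k`-marble bimachine, and an output function with values in this set. -/
inductive MarbleBimachine (A : Type u) (M : Type v) : ℕ → Type (max u v)
  | base (out : M → A → M → ℕ) : MarbleBimachine A M 1
  | step {k : ℕ} (n : ℕ) (sub : Fin n → MarbleBimachine A M (k + 1)) (out : M → A → M → Fin n) :
      MarbleBimachine A M (k + 2)

/-- Production of a `k`-marble bimachine on the word `w` and the positions `i_k ≥ ⋯ ≥ i_1`, listed
in decreasing order (positions are numbered from `0`): the letter of position `i_k` and its two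
contexts select a submachine, which is run on the prefix of `w` ending in position `i_k` (included)
with the remaining positions. It is `0` on lists which are not of this form. -/
def MarbleBimachine.prodList {A : Type u} {M : Type v} [Monoid M] (μ : FreeMonoid A →* M) :
    {k : ℕ} → MarbleBimachine A M k → List A → List ℕ → ℕ
  | _, .base out, w, [i] =>
      match w[i]? with
      | some a => out (val μ (w.take i)) a (val μ (w.drop (i + 1)))
      | none => 0
  | _, .step _ sub out, w, i :: is =>
      match w[i]? with
      | some a =>
          (sub (out (val μ (w.take i)) a (val μ (w.drop (i + 1))))).prodList μ (w.take (i + 1)) is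
      | none => 0
  | _, _, _, _ => 0

/-- Production on a multiset of `k` positions of `w`. -/
def MarbleBimachine.prodAt {A : Type u} {M : Type v} [Monoid M] (μ : FreeMonoid A →* M) {k : ℕ}
    (B : MarbleBimachine A M k) (w : List A) (S : Multiset ℕ) : ℕ :=
  B.prodList μ w (S.sort (· ≥ ·))

open Classical in
/-- Production on a multiset `{{I_1, …, I_k}}` of sets of positions of `w`: the sum of the
productions on all the multisets `{{i_1, …, i_k}}` of positions such that `i_j ∈ I_j` for all `j`
(for a suitable numbering). -/
def MarbleBimachine.prodSets {A : Type u} {M : Type v} [Monoid M] (μ : FreeMonoid A →* M) {k : ℕ}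
    (B : MarbleBimachine A M k) (w : List A) (I : Multiset (Finset ℕ)) : ℕ :=
  ∑ S : Sym (Fin w.length) k with
      Multiset.Rel (fun (i : Fin w.length) (J : Finset ℕ) => (i : ℕ) ∈ J) (S : Multiset _) I,
    B.prodAt μ w ((S : Multiset (Fin w.length)).map (fun i => (i : ℕ)))

/-! ### Multicontexts -/

/-- Multicontexts `m_0 ⟦u_1⟧ m_1 ⋯ ⟦u_x⟧ m_x` with `m_i ∈ M` and `u_i ∈ A*`. -/
inductive Multicontext (A : Type u) (M : Type v) : Type (max u v)
  | elem (m : M) : Multicontext A M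
  | cons (m : M) (w : List A) (c : Multicontext A M) : Multicontext A M

namespace Multicontext

/-- The multicontext `⟦w⟧`. -/
def mark {A : Type u} {M : Type v} [Monoid M] (w : List A) : Multicontext A M :=
  cons 1 w (elem 1)

/-- Multiply the first element `m_0` on the left by `m`. -/
def lmul {A : Type u} {M : Type v} [Monoid M] (m : M) : Multicontext A M → Multicontext A M
  | elem n => elem (m * n)
  | cons n w c => cons (m * n) w c

/-- Concatenation of multicontexts: the two elements of `M` which meet are multiplied. -/
def concat {A : Type u} {M : Type v} [Monoid M] :
    Multicontext A M → Multicontext A M → Multicontext A M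
  | elem m, d => lmul m d
  | cons m w c, d => cons m w (concat c d)

instance {A : Type u} {M : Type v} [Monoid M] : Monoid (Multicontext A M) where
  mul := concat
  one := elem 1
  one_mul c := by
    change concat (elem 1) c = c
    cases c <;> simp [concat, lmul]
  mul_one c := by
    change concat c (elem 1) = c
    induction c with
    | elem m => simp [concat, lmul]
    | cons m w c ih => simp [concat, ih]
  mul_assoc a b c := by
    change concat (concat a b) c = concat a (concat b c)
    induction a with
    | elem m => cases b with
      | elem n => cases c <;> simp [concat, lmul, mul_assoc]
      | cons n w b => simp [concat, lmul]
    | cons m w a ih => simp [concat, ih]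

/-- Apply a map to all the elements `m_i`. -/
def map {A : Type u} {M N : Type*} (g : M → N) : Multicontext A M → Multicontext A N
  | elem m => elem (g m)
  | cons m w c => cons (g m) w (map g c)

/-- The word `v_0 u_1 v_1 ⋯ u_x v_x` described by `v_0 ⟦u_1⟧ v_1 ⋯ ⟦u_x⟧ v_x`. -/
def word {A : Type u} : Multicontext A (List A) → List A
  | elem v => v
  | cons v w c => v ++ w ++ word c

/-- The sets of positions of `u_1, …, u_x` in the word `v_0 u_1 v_1 ⋯ u_x v_x`, when the first
position of this word is numbered `s`. -/
def blocks {A : Type u} : Multicontext A (List A) → ℕ → Multiset (Finset ℕ)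
  | elem _, _ => 0
  | cons v w c, s =>
      Finset.Ico (s + v.length) (s + v.length + w.length) ::ₘ
        blocks c (s + v.length + w.length)

end Multicontext

/-- Production `prod(v_0 ⟦u_1⟧ v_1 ⋯ ⟦u_k⟧ v_k)` on the factors `u_1, …, u_k` of the word
`v_0 u_1 v_1 ⋯ u_k v_k`. -/
def MarbleBimachine.prodFactors {A : Type u} {M : Type v} [Monoid M] (μ : FreeMonoid A →* M)
    {k : ℕ} (B : MarbleBimachine A M k) (c : Multicontext A (List A)) : ℕ :=
  B.prodSets μ c.word (c.blocks 0)

/-- Production `prod(m_0 ⟦u_1⟧ m_1 ⋯ ⟦u_k⟧ m_k)` on a multicontext: choose words `v_i` with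
`μ(v_i) = m_i` (the production only depends on the `m_i`). -/
def MarbleBimachine.prod {A : Type u} {M : Type v} [Monoid M] (μ : FreeMonoid A →* M)
    (hμ : Function.Surjective μ) {k : ℕ} (B : MarbleBimachine A M k) (c : Multicontext A M) : ℕ :=
  B.prodFactors μ (c.map fun m => FreeMonoid.toList (Function.surjInv hμ m))

/-! ### Iterators and permutability -/

/-- The multicontext `m_0 ∏_{i=1}^x e_i ⟦u_i⟧ e_i m_i` with `e_i = μ(u_i)`. -/
def iteratorForm {A : Type u} {M : Type v} [Monoid M] (μ : FreeMonoid A →* M) {x : ℕ}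
    (m : Fin (x + 1) → M) (w : Fin x → List A) : Multicontext A M :=
  .elem (m 0) *
    (List.ofFn fun i : Fin x =>
      .elem (val μ (w i)) * .mark (w i) * .elem (val μ (w i)) * .elem (m i.succ)).prod

/-- `(x, K)`-iterators: the multicontexts `m_0 ∏_{i=1}^x e_i ⟦u_i⟧ e_i m_i` such that every
`e_i = μ(u_i)` is idempotent and every `u_i` has length at most `K`. -/
def IsIterator {A : Type u} {M : Type v} [Monoid M] (μ : FreeMonoid A →* M) (x K : ℕ)
    (c : Multicontext A M) : Prop :=
  ∃ (m : Fin (x + 1) → M) (w : Fin x → List A),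
    (∀ i, IsIdempotentElem (val μ (w i)) ∧ (w i).length ≤ K) ∧ c = iteratorForm μ m w

/-- `m_0 ∏_{i=1}^x e_i m_i`. -/
def iteratorVal {A : Type u} {M : Type v} [Monoid M] (μ : FreeMonoid A →* M) {x : ℕ}
    (m : Fin (x + 1) → M) (w : Fin x → List A) : M :=
  m 0 * (List.ofFn fun i : Fin x => val μ (w i) * m i.succ).prod

/-- `left_j = e ∏_{i=1}^j m_{i-1} e_i`, where `e = m_0 ∏_{i=1}^x e_i m_i`. -/
def leftCtx {A : Type u} {M : Type v} [Monoid M] (μ : FreeMonoid A →* M) {x : ℕ}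
    (m : Fin (x + 1) → M) (w : Fin x → List A) (j : Fin x) : M :=
  iteratorVal μ m w *
    ((List.ofFn fun i : Fin x => m i.castSucc * val μ (w i)).take (j + 1)).prod

/-- `right_j = (∏_{i=j}^x e_i m_i) e`, where `e = m_0 ∏_{i=1}^x e_i m_i`. -/
def rightCtx {A : Type u} {M : Type v} [Monoid M] (μ : FreeMonoid A →* M) {x : ℕ}
    (m : Fin (x + 1) → M) (w : Fin x → List A) (j : Fin x) : M :=
  ((List.ofFn fun i : Fin x => val μ (w i) * m i.succ).drop j).prod * iteratorVal μ m w

/-- `K`-permutable `k`-marble bimachines. -/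
def IsPermutable {A : Type u} {M : Type v} [Monoid M] (μ : FreeMonoid A →* M)
    (hμ : Function.Surjective μ) {k : ℕ} (B : MarbleBimachine A M k) (K : ℕ) : Prop :=
  ∀ l x r : ℕ, 1 ≤ x → l + x + r = k →
    ∀ L R : Multicontext A M, IsIterator μ l K L → IsIterator μ r K R →
      ∀ (m : Fin (x + 1) → M) (w : Fin x → List A),
        (∀ i, IsIdempotentElem (val μ (w i)) ∧ (w i).length ≤ K) →
        IsIdempotentElem (iteratorVal μ m w) →
        ∀ σ : Equiv.Perm (Fin x),
          B.prod μ hμ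
              (L * .elem (iteratorVal μ m w) * iteratorForm μ m w * .elem (iteratorVal μ m w) * R) =
            B.prod μ hμ
              (L *
                (List.ofFn fun i : Fin x =>
                  .elem (leftCtx μ m w (σ i)) * .mark (w (σ i)) *
                    .elem (rightCtx μ m w (σ i))).prod *
                R)

/-! ### Factorization forests -/

/-- Forests: `a` with `a ∈ A`, or `⟨F_1⟩ ⋯ ⟨F_n⟩` with `n ≥ 0` (it is `ε` when `n = 0`). -/
inductive Forest (A : Type u) : Type u
  | leaf (a : A) : Forest A
  | node (ts : List (Forest A)) : Forest A

namespace Forest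

/-- The word factored by a forest. -/
def word {A : Type u} : Forest A → List A
  | leaf a => [a]
  | node ts => ts.flatMap fun t => word t

/-- The height of a forest: it is `0` for letters and for `ε`. -/
def height {A : Type u} : Forest A → ℕ
  | leaf _ => 0
  | node ts => (ts.map fun t => height t + 1).foldr max 0

/-- The subforest rooted in the node `p`. A node is the path which leads to it from the root, i.e.
the list of the indices (numbered from `0`) of the successive children. It is `none` if there is no
such node. -/
def subforest {A : Type u} : Forest A → List ℕ → Option (Forest A)
  | F, [] => some F
  | leaf _, _ :: _ => none
  | node ts, j :: p => ts[j]?.bind fun t => subforest t p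

/-- The set of the positions of the leaves of the skeleton of `F`, i.e. the leaves which are reached
from the root by always moving to the leftmost or to the rightmost child. -/
def rootFrontier {A : Type u} : Forest A → Finset ℕ
  | leaf _ => {0}
  | node [] => ∅
  | node (t :: ts) =>
      rootFrontier t ∪
        (rootFrontier ((t :: ts).getLast (List.cons_ne_nil t ts))).image
          (((t :: ts).dropLast.flatMap word).length + ·)
termination_by F => sizeOf F
decreasing_by
  · simp
    omega
  · have := List.sizeOf_lt_of_mem (List.getLast_mem (List.cons_ne_nil t ts))
    simp at this ⊢
    omega

/-- The frontier of the node `p` of `F`, as a set of positions of the word factored by `F`. -/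
def frontier {A : Type u} : Forest A → List ℕ → Finset ℕ
  | F, [] => rootFrontier F
  | leaf _, _ :: _ => ∅
  | node ts, j :: p =>
      match ts[j]? with
      | some t => (frontier t p).image (((ts.take j).flatMap word).length + ·)
      | none => ∅

/-- A node is iterable if it has a left sibling and a right sibling. -/
def IsIterable {A : Type u} (F : Forest A) (p : List ℕ) : Prop :=
  ∃ (q : List ℕ) (j : ℕ) (ts : List (Forest A)),
    p = q ++ [j] ∧ F.subforest q = some (node ts) ∧ 1 ≤ j ∧ j + 1 < ts.length

end Forest

/-- The nodes `p` and `q` are consecutive children of the same node. -/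
def AreSiblings (p q : List ℕ) : Prop :=
  ∃ (s : List ℕ) (j : ℕ), (p = s ++ [j] ∧ q = s ++ [j + 1]) ∨ (p = s ++ [j + 1] ∧ q = s ++ [j])

/-- `T` is an independent set of `x` nodes of `F`: it consists of iterable nodes, and no node of `T`
is an ancestor of another node of `T`, or the (left or right) sibling of an ancestor of another node
of `T` (a node is an ancestor of itself). -/
def IsIndependent {A : Type u} (F : Forest A) (x : ℕ) (T : Finset (List ℕ)) : Prop :=
  T.card = x ∧ (∀ t ∈ T, F.IsIterable t) ∧
    ∀ t ∈ T, ∀ t' ∈ T, t ≠ t' → ¬ t <+: t' ∧ ∀ s, AreSiblings t s → ¬ s <+: t'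

/-- Every node `⟨F_1⟩ ⋯ ⟨F_n⟩` of the forest satisfies the conditions of a `μ`-factorization: the
words factored by the `F_i` are nonempty and, if `n ≥ 3`, they have the same idempotent value. -/
inductive IsFactorization {A : Type u} {M : Type v} [Monoid M] (μ : FreeMonoid A →* M) :
    Forest A → Prop
  | leaf (a : A) : IsFactorization μ (.leaf a)
  | node (ts : List (Forest A)) (hts : ∀ t ∈ ts, IsFactorization μ t)
      (hne : ∀ t ∈ ts, t.word ≠ [])
      (hidem : 3 ≤ ts.length → ∃ e : M, IsIdempotentElem e ∧ ∀ t ∈ ts, val μ t.word = e) :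
      IsFactorization μ (.node ts)

/-- The `μ`-factorization forests of `w` of height at most `h`. -/
def factorizations {A : Type u} {M : Type v} [Monoid M] (μ : FreeMonoid A →* M) (h : ℕ)
    (w : List A) : Set (Forest A) :=
  {F | IsFactorization μ F ∧ F.word = w ∧ F.height ≤ h}

/-- The production on a set `T` of nodes of a forest: the production on their frontiers. -/
def MarbleBimachine.prodForest {A : Type u} {M : Type v} [Monoid M] (μ : FreeMonoid A →* M) {k : ℕ}
    (B : MarbleBimachine A M k) (F : Forest A) (T : Finset (List ℕ)) : ℕ :=
  B.prodSets μ F.word (T.val.map F.frontier)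

/-! ### Linearizations -/

/-- The word `w[I]` which consists of the letters of `w` whose position is in `I`. -/
def restrict {A : Type u} (w : List A) (I : Finset ℕ) : List A :=
  (w.zipIdx.filter fun a => a.2 ∈ I).map Prod.fst

/-- The nodes of `T` which are in the child of index `j` of the root, as nodes of this child. -/
def childNodes (T : Finset (List ℕ)) (j : ℕ) : Finset (List ℕ) :=
  T.preimage (List.cons j) List.cons_injective.injOn

/-- The linearization of a set `T` of nodes of `F`, for `T` independent or `T = {F}`. -/
def lin {A : Type u} {M : Type v} [Monoid M] (μ : FreeMonoid A →* M) :
    Forest A → Finset (List ℕ) → Multicontext A M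
  | F, T =>
    if T = ∅ then .elem (val μ F.word)
    else if T = {[]} then .mark (restrict F.word F.rootFrontier)
    else
      match F with
      | .leaf a => .elem (val μ [a])
      | .node ts => (List.ofFn fun j : Fin ts.length => lin μ ts[j] (childNodes T j)).prod
termination_by F => sizeOf F
decreasing_by
  have := List.sizeOf_lt_of_mem (List.getElem_mem j.isLt)
  simp at this ⊢
  omega

/-! ### Architectures -/

/-- The symbols which occur in architectures: `a`, `⟨m⟩`, `⟨𝕋⟩` for a multiset `𝕋` of pairs made of a
multicontext and a depth, and `⟨𝔸⟩` for an architecture `𝔸`. -/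
inductive ArchSymbol (A : Type u) (M : Type v) : Type (max u v)
  | letter (a : A) : ArchSymbol A M
  | value (m : M) : ArchSymbol A M
  | types (T : Multiset (Multicontext A M × ℕ)) : ArchSymbol A M
  | nested (l : List (ArchSymbol A M)) : ArchSymbol A M

/-- Add `1` to the first index of a path. -/
def shiftPath : List ℕ → List ℕ
  | [] => []
  | j :: p => (j + 1) :: p

lemma shiftPath_injective : Function.Injective shiftPath := by
  intro p q h
  cases p <;> cases q <;> simp_all [shiftPath]

/-- The nodes of `T` which are not in the first child `F_1` of `⟨F_1⟩ ⋯ ⟨F_n⟩`, as nodes of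
`⟨F_2⟩ ⋯ ⟨F_n⟩`. -/
def tailNodes (T : Finset (List ℕ)) : Finset (List ℕ) :=
  T.preimage shiftPath shiftPath_injective.injOn

/-- The architecture of a set `T` of independent nodes of `F`. It is `a` if `F = a`, and `ε` if
`F = ε`. If `F = ⟨F_1⟩ ⋯ ⟨F_n⟩` with `n ≥ 1`, let `T_j` be the set of nodes of `T` in `F_j`. Then it is
* `⟨μ(F)⟩` if `T` is empty;
* otherwise `⟨arch_{F_1}(T_1)⟩ arch_{⟨F_2⟩⋯⟨F_n⟩}(T ∖ T_1)` if `T_1` is nonempty;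
* otherwise `arch_{⟨F_1⟩⋯⟨F_{n-1}⟩}(T ∖ T_n) ⟨arch_{F_n}(T_n)⟩` if `T_n` is nonempty;
* otherwise `⟨𝕋⟩`, where `𝕋` is the multiset of all the `(lin_F({t}), depth_F(t))` for `t ∈ T`. -/
def arch {A : Type u} {M : Type v} [Monoid M] (μ : FreeMonoid A →* M) :
    Forest A → Finset (List ℕ) → List (ArchSymbol A M)
  | .leaf a, _ => [.letter a]
  | .node [], _ => []
  | .node (t :: ts), T =>
      if T = ∅ then [.value (val μ (Forest.node (t :: ts)).word)]
      else if childNodes T 0 ≠ ∅ then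
        .nested (arch μ t (childNodes T 0)) :: arch μ (.node ts) (tailNodes T)
      else if childNodes T ts.length ≠ ∅ then
        arch μ (.node (t :: ts).dropLast) (T.filter fun p => p.head? ≠ some ts.length) ++
          [.nested
            (arch μ ((t :: ts).getLast (List.cons_ne_nil t ts)) (childNodes T ts.length))]
      else [.types (T.val.map fun p => (lin μ (.node (t :: ts)) {p}, p.length))]
termination_by F => sizeOf F
decreasing_by
  · simp
    omega
  · simp
  · have h : ∀ (s : Forest A) (l : List (Forest A)),
        sizeOf (s :: l).dropLast < sizeOf (s :: l) := by
      intro s l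
      induction l generalizing s with
      | nil => simp
      | cons b l ih =>
        have := ih b
        simp at this ⊢
        omega
    have := h t ts
    simp at this ⊢
    omega
  · have := List.sizeOf_lt_of_mem (List.getLast_mem (List.cons_ne_nil t ts))
    simp at this ⊢
    omega

end MarbleArch

end

namespace MarbleArch

universe u v

/-! ### Values of words and multicontexts -/

section Values

variable {A : Type u} {M : Type v} [Monoid M] (μ : FreeMonoid A →* M)

/-! The architecture records how a linearization is assembled, up to one ambiguity: when `T` meets
neither the first nor the last child, only the multiset of the one-mark linearizations `lin F {t}`
is kept, not their order. Permutability says precisely that this order is invisible to the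
production.

Two facts make permutability applicable. First, the linearization of an independent set is an
iterator (`iter_lin`). Each marked word has the idempotent value `e` of its siblings, and its
immediate siblings, which independence keeps free of marks, supply the factors `e` on both sides. A
frontier at most doubles with each level, so marked words have length at most `2 ^ h` in a forest of
height `h`. The number `3|M|` enters only as such an `h`. Second, erasing all marks of an iterator
but one, by replacing the other marked words with their values, gives the factors `left_j ⟦u_j⟧
right_j` up to outer factors `e` (`singles_iteratorForm`). For a linearization the same operation
gives the multicontexts `lin F {t}` (`coe_singles_lin`). This rests on the fact that a word and its
frontier word have the same value (`sameContexts_rootFrontier`). So in the ambiguous case two equal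
architectures have the same factors up to order, and `prod_eq_of_singles_perm` concludes.

In the other cases the architecture splits off a first or last child, and so does the linearization,
as a product. The two factors are exchanged one after the other by induction, the factor at rest
being an iterator absorbed into `L` or `R` (`prod_lin_eq_of_arch_eq`). The alternatives cannot be
confused, as the outermost symbols tell them apart (`archCases`).

The second claim is the first one with trivial `L` and `R`, once the production on frontiers is
identified with that of the linearization (`prodForest_eq_prod_lin`). A bimachine sees a marked
letter only through the letter and the values of its two contexts, and these are the same in the
full word and in the frontier word. -/

@[simp] lemma val_nil : val μ [] = 1 := map_one μ

@[simp] lemma val_append (u v : List A) : val μ (u ++ v) = val μ u * val μ v :=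
  map_mul μ (FreeMonoid.ofList u) (FreeMonoid.ofList v)

namespace Multicontext

lemma elem_mul_elem (m n : M) : (elem m * elem n : Multicontext A M) = elem (m * n) := rfl

lemma elem_mul_cons (m n : M) (u : List A) (c : Multicontext A M) :
    elem m * cons n u c = cons (m * n) u c := rfl

lemma cons_mul (m : M) (u : List A) (c d : Multicontext A M) :
    cons m u c * d = cons m u (c * d) := rfl

lemma one_def : (1 : Multicontext A M) = elem 1 := rfl

lemma cons_eq (m : M) (u : List A) (c : Multicontext A M) :
    cons m u c = elem m * mark u * c := by
  cases c <;> simp [mark, elem_mul_cons, cons_mul, elem_mul_elem]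

/-- The value in `M` of a multicontext, where every marked word is replaced by its value. -/
def value : Multicontext A M → M
  | elem m => m
  | cons m u c => m * val μ u * value c

@[simp] lemma value_elem (m : M) : value μ (elem m : Multicontext A M) = m := rfl

@[simp] lemma value_mark (u : List A) : value μ (mark u : Multicontext A M) = val μ u := by
  simp [value, mark]

@[simp] lemma value_mul (c d : Multicontext A M) : value μ (c * d) = value μ c * value μ d := by
  induction c with
  | elem m => cases d <;> simp [value, elem_mul_elem, elem_mul_cons, mul_assoc]
  | cons m u c ih => simp [value, cons_mul, ih, mul_assoc]

@[simp] lemma value_one : value μ (1 : Multicontext A M) = 1 := rfl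

/-- The multicontexts with a single mark obtained from `c` by replacing all the marked words but one
by their values. -/
def singles : Multicontext A M → List (Multicontext A M)
  | elem _ => []
  | cons m u c => cons m u (elem (value μ c)) :: (singles c).map (elem (m * val μ u) * ·)

lemma singles_mark (u : List A) : singles μ (mark u : Multicontext A M) = [mark u] := by
  simp [singles, mark]

/-- A Leibniz rule: the surviving mark lies in one factor, and the other factor is seen only through
its value. It lets `singles` be computed along products, both for iterators and for linearizations.
-/
lemma singles_mul (c d : Multicontext A M) :
    singles μ (c * d) =
      (singles μ c).map (· * elem (value μ d)) ++ (singles μ d).map (elem (value μ c) * ·) := by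
  induction c with
  | elem m =>
    cases d with
    | elem n => simp [singles, elem_mul_elem]
    | cons n u d =>
      simp [singles, elem_mul_cons, Function.comp_def, ← mul_assoc, elem_mul_elem]
  | cons m u c ih =>
    simp [singles, cons_mul, ih, elem_mul_elem, Function.comp_def, ← mul_assoc, value]

end Multicontext

end Values

/-! ### Iterators and a reformulation of permutability -/

section Iterators

variable {A : Type u} {M : Type v} [Monoid M] (μ : FreeMonoid A →* M)

open Multicontext

/-- Inductive description of the `(x, K)`-iterators. -/
inductive Iter (K : ℕ) : ℕ → Multicontext A M → Prop
  | elem (m : M) : Iter K 0 (.elem m)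
  | cons {x : ℕ} {c : Multicontext A M} (m : M) (u : List A)
      (hu : IsIdempotentElem (val μ u)) (hK : u.length ≤ K) (hc : Iter K x c) :
      Iter K (x + 1) (.elem m * (.elem (val μ u) * mark u * .elem (val μ u)) * c)

variable {μ} {K : ℕ}

lemma Iter.elem_mul {x : ℕ} {c : Multicontext A M} (n : M) (hc : Iter μ K x c) :
    Iter μ K x (.elem n * c) := by
  cases hc with
  | elem m => exact .elem _
  | cons m u hu hK hc =>
    rw [← mul_assoc, ← mul_assoc, elem_mul_elem]
    exact .cons _ u hu hK hc

lemma Iter.mul {x y : ℕ} {c d : Multicontext A M} (hc : Iter μ K x c) (hd : Iter μ K y d) :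
    Iter μ K (x + y) (c * d) := by
  induction hc with
  | elem m => simpa using hd.elem_mul m
  | @cons x c m u hu hK hc ih =>
    rw [mul_assoc, show x + 1 + y = x + y + 1 by omega]
    exact .cons m u hu hK ih

lemma Iter.mark {u : List A} (hu : IsIdempotentElem (val μ u)) (hK : u.length ≤ K) :
    Iter μ K 1 (.elem (val μ u) * .mark u * .elem (val μ u)) := by
  have := Iter.cons (K := K) 1 u hu hK (.elem (1 : M))
  rwa [← one_def, one_mul, mul_one] at this

lemma iteratorForm_succ {x : ℕ} (m : Fin (x + 2) → M) (w : Fin (x + 1) → List A) :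
    iteratorForm μ m w =
      .elem (m 0) * (.elem (val μ (w 0)) * .mark (w 0) * .elem (val μ (w 0))) *
        iteratorForm μ (fun i => m i.succ) (fun i => w i.succ) := by
  simp [iteratorForm, List.ofFn_succ, mul_assoc]

lemma isIterator_iff_iter {x : ℕ} {c : Multicontext A M} :
    IsIterator μ x K c ↔ Iter μ K x c := by
  constructor
  · rintro ⟨m, w, hw, rfl⟩
    induction x with
    | zero =>
      have : iteratorForm μ m w = .elem (m 0) := by
        simp [iteratorForm]
      rw [this]
      exact .elem _
    | succ x ih =>
      rw [iteratorForm_succ]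
      exact .cons _ _ (hw 0).1 (hw 0).2 (ih _ _ fun i => hw i.succ)
  · intro h
    induction h with
    | elem m => exact ⟨fun _ => m, Fin.elim0, fun i => i.elim0, by simp [iteratorForm]⟩
    | cons m u hu hK hc ih =>
      obtain ⟨m', w, hw, rfl⟩ := ih
      refine ⟨Fin.cons m m', Fin.cons u w, fun i => ?_, ?_⟩
      · cases i using Fin.cases with
        | zero => exact ⟨hu, hK⟩
        | succ i => exact hw i
      · simp [iteratorForm_succ]

lemma value_iteratorForm {x : ℕ} (m : Fin (x + 1) → M) (w : Fin x → List A)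
    (hw : ∀ i, IsIdempotentElem (val μ (w i))) :
    value μ (iteratorForm μ m w) = iteratorVal μ m w := by
  induction x with
  | zero => simp [iteratorForm, iteratorVal]
  | succ x ih =>
    rw [iteratorForm_succ]
    simp only [value_mul, ih _ _ fun i => hw i.succ, value_elem, value_mark, (hw 0).eq]
    simp [iteratorVal, List.ofFn_succ, mul_assoc]

/-- Each erased block `e_i ⟦u_i⟧ e_i` collapses to `e_i` by idempotency. What remains is `left_j
⟦u_j⟧ right_j` without the outer factors `e`. -/
lemma singles_iteratorForm {x : ℕ} (m : Fin (x + 1) → M) (w : Fin x → List A)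
    (hw : ∀ i, IsIdempotentElem (val μ (w i))) :
    singles μ (iteratorForm μ m w) = List.ofFn fun j : Fin x =>
      .elem ((List.ofFn fun i : Fin x => m i.castSucc * val μ (w i)).take (j + 1)).prod *
        .mark (w j) * .elem ((List.ofFn fun i : Fin x => val μ (w i) * m i.succ).drop j).prod := by
  induction x with
  | zero => simp [iteratorForm, singles]
  | succ x ih =>
    rw [iteratorForm_succ, singles_mul, ih _ _ fun i => hw i.succ,
      value_iteratorForm _ _ fun i => hw i.succ, singles_mul, singles_mul, singles_mul]
    simp only [singles, singles_mark]
    simp [List.ofFn_succ, iteratorVal, mul_assoc, elem_mul_elem, (hw 0).eq]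
    simp [← mul_assoc, elem_mul_elem, Function.comp_def]

/-- Over each value, the two index fibres have the same cardinality; bijections between the fibres
glue to `σ`. -/
lemma exists_comp_of_perm_ofFn {α : Type*} {n : ℕ} {s : List α} {g : Fin n → α}
    (h : s.Perm (List.ofFn g)) : ∃ σ : Equiv.Perm (Fin n), s = List.ofFn (g ∘ σ) := by
  classical
  obtain ⟨f, rfl⟩ : ∃ f : Fin n → α, s = List.ofFn f := by
    have hn : s.length = n := by rw [h.length_eq, List.length_ofFn]
    subst hn
    exact ⟨s.get, (List.ofFn_get s).symm⟩
  have hcard (a : α) : Nonempty ({i // f i = a} ≃ {i // g i = a}) := by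
    refine ⟨Fintype.equivOfCardEq ?_⟩
    have := congrArg (Multiset.count a) (Multiset.coe_eq_coe.2 h)
    rw [← Fin.univ_val_map, ← Fin.univ_val_map, Multiset.count_map, Multiset.count_map] at this
    simp only [eq_comm (a := a)] at this
    simpa [Fintype.card_subtype, Finset.card_def, Finset.filter_val] using this
  let σ : Equiv.Perm (Fin n) := (Equiv.sigmaFiberEquiv f).symm.trans
    ((Equiv.sigmaCongrRight fun a => (hcard a).some).trans (Equiv.sigmaFiberEquiv g))
  refine ⟨σ, congrArg List.ofFn (funext fun i => ?_)⟩
  exact ((hcard (f i)).some ⟨i, rfl⟩).2.symm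

variable {hμ : Function.Surjective μ}

/-- The usable form of permutability: it mentions neither the decomposition of `c` nor a permutation
of indices, only the unordered family of its one-mark erasures. -/
lemma prod_eq_of_singles_perm {k : ℕ} {B : MarbleBimachine A M k} (hB : IsPermutable μ hμ B K)
    {l x r : ℕ} (hx : 1 ≤ x) (hk : l + x + r = k) {L R c : Multicontext A M}
    (hL : IsIterator μ l K L) (hR : IsIterator μ r K R)
    (hc : IsIterator μ x K c) (he : IsIdempotentElem (value μ c))
    (hlc : .elem (value μ c) * c = c) (hrc : c * .elem (value μ c) = c)
    {s : List (Multicontext A M)} (hperm : s.Perm (singles μ c)) :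
    B.prod μ hμ (L * c * R) = B.prod μ hμ (L * s.prod * R) := by
  obtain ⟨m, w, hw, hcw⟩ := hc
  have hval : value μ c = iteratorVal μ m w := by
    rw [hcw, value_iteratorForm m w fun i => (hw i).1]
  have hs : singles μ c = List.ofFn fun j : Fin x =>
      (.elem (leftCtx μ m w j) * .mark (w j) * .elem (rightCtx μ m w j)) := by
    -- As `c` absorbs its value on both sides, so does each of its singles; this provides the outer
    -- `e` of `left_j` and `right_j`.
    have : singles μ c = (singles μ c).map (.elem (value μ c) * · * .elem (value μ c)) := by
      have hd := singles_mul μ (.elem (value μ c) * c) (.elem (value μ c))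
      rw [hlc, hrc] at hd
      have hd' := singles_mul μ (.elem (value μ c)) c
      rw [hlc] at hd'
      nth_rewrite 1 [hd, hd']
      simp [singles, Function.comp_def]
    rw [this, hval, hcw, singles_iteratorForm m w fun i => (hw i).1, List.map_ofFn]
    congr 1
    funext j
    simp [leftCtx, rightCtx, ← elem_mul_elem, mul_assoc]
  rw [hs] at hperm
  obtain ⟨σ, rfl⟩ := exists_comp_of_perm_ofFn hperm
  have := hB l x r hx hk L R hL hR m w hw (hval ▸ he) σ
  rw [← hcw, ← hval, mul_assoc L, hlc, mul_assoc L, hrc] at this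
  exact this

end Iterators

/-! ### Splitting sets of nodes along the first child -/

section Paths

variable {T : Finset (List ℕ)}

@[simp] lemma mem_childNodes {p : List ℕ} {j : ℕ} : p ∈ childNodes T j ↔ j :: p ∈ T := by
  simp [childNodes]

@[simp] lemma mem_tailNodes {p : List ℕ} : p ∈ tailNodes T ↔ shiftPath p ∈ T := by
  simp [tailNodes]

@[simp] lemma childNodes_empty (j : ℕ) : childNodes ∅ j = ∅ := by ext; simp

lemma childNodes_tailNodes (j : ℕ) : childNodes (tailNodes T) j = childNodes T (j + 1) := by
  ext; simp [shiftPath]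

lemma val_eq_childNodes_add_tailNodes (hT : [] ∉ T) :
    T.val = (childNodes T 0).val.map (List.cons 0) + (tailNodes T).val.map shiftPath := by
  rw [← Finset.image_val_of_injOn (s := childNodes T 0) List.cons_injective.injOn,
    ← Finset.image_val_of_injOn (s := tailNodes T) shiftPath_injective.injOn]
  have hd : Disjoint ((childNodes T 0).image (List.cons 0)) ((tailNodes T).image shiftPath) := by
    rw [Finset.disjoint_left]
    intro p hp hq
    simp only [Finset.mem_image, mem_childNodes, mem_tailNodes] at hp hq
    obtain ⟨a, -, rfl⟩ := hp
    obtain ⟨b, -, hb⟩ := hq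
    cases b <;> simp [shiftPath] at hb
  rw [← Finset.disjUnion_val _ _ hd, Finset.val_inj]
  ext p
  simp only [Finset.mem_disjUnion, Finset.mem_image, mem_childNodes, mem_tailNodes]
  constructor
  · intro hp
    match p with
    | [] => exact absurd hp hT
    | 0 :: p => exact .inl ⟨p, hp, rfl⟩
    | (j + 1) :: p => exact .inr ⟨j :: p, hp, rfl⟩
  · rintro (⟨a, ha, rfl⟩ | ⟨a, ha, rfl⟩) <;> assumption

lemma card_eq_childNodes_add_tailNodes (hT : [] ∉ T) :
    T.card = (childNodes T 0).card + (tailNodes T).card := by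
  have := congrArg Multiset.card (val_eq_childNodes_add_tailNodes hT)
  simpa using this

lemma childNodes_eq_empty_iff {j : ℕ} : childNodes T j = ∅ ↔ ∀ p, j :: p ∉ T := by
  simp [Finset.ext_iff]

@[simp] lemma shiftPath_nil : shiftPath [] = [] := rfl

end Paths

/-! ### Induction, words, heights and frontiers of forests -/

section Forests

variable {A : Type u}

/-- Induction on forests, where the children of a node are added one by one. -/
theorem Forest.consInduction {P : Forest A → Prop} (leaf : ∀ a, P (.leaf a)) (nil : P (.node []))
    (cons : ∀ t ts, P t → P (.node ts) → P (.node (t :: ts))) (F : Forest A) : P F :=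
  Forest.rec (motive_1 := P) (motive_2 := fun ts => P (.node ts)) leaf (fun _ h => h) nil cons F

/-- Induction on forests, where the hypothesis holds for all the children of a node. -/
theorem Forest.childInduction {P : Forest A → Prop} (leaf : ∀ a, P (.leaf a))
    (node : ∀ ts, (∀ t ∈ ts, P t) → P (.node ts)) (F : Forest A) : P F :=
  Forest.rec (motive_1 := P) (motive_2 := fun ts => ∀ t ∈ ts, P t) leaf node (by simp)
    (fun _ _ h hs => by simpa using ⟨h, hs⟩) F

lemma Forest.word_nil : (Forest.node [] : Forest A).word = [] := by simp [Forest.word]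

lemma Forest.word_cons (t : Forest A) (ts : List (Forest A)) :
    (Forest.node (t :: ts)).word = t.word ++ (Forest.node ts).word := by simp [Forest.word]

lemma Forest.word_append (ts ts' : List (Forest A)) :
    (Forest.node (ts ++ ts')).word = (Forest.node ts).word ++ (Forest.node ts').word := by
  simp [Forest.word]

lemma Forest.height_le_of_mem {t : Forest A} {ts : List (Forest A)} (h : t ∈ ts) :
    t.height + 1 ≤ (Forest.node ts).height := by
  induction ts with
  | nil => simp at h
  | cons s ts ih =>
    rcases List.mem_cons.1 h with rfl | h
    · simp [Forest.height]
    · have := ih h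
      simp only [Forest.height, List.map_cons, List.foldr_cons] at this ⊢
      omega

lemma Forest.height_node_le {ts : List (Forest A)} {h : ℕ} :
    (Forest.node ts).height ≤ h ↔ ∀ t ∈ ts, t.height + 1 ≤ h := by
  refine ⟨fun hh t ht => (Forest.height_le_of_mem ht).trans hh, ?_⟩
  induction ts with
  | nil => simp [Forest.height]
  | cons s ts ih =>
    intro hh
    have h1 := hh s (by simp)
    have h2 := ih fun t ht => hh t (by simp [ht])
    simp only [Forest.height, List.map_cons, List.foldr_cons] at h2 ⊢
    omega

lemma Forest.rootFrontier_singleton (t : Forest A) :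
    (Forest.node [t]).rootFrontier = t.rootFrontier := by
  rw [Forest.rootFrontier]
  simp

lemma Forest.rootFrontier_cons_concat (t s : Forest A) (ts : List (Forest A)) :
    (Forest.node (t :: (ts ++ [s]))).rootFrontier = t.rootFrontier ∪
      s.rootFrontier.image ((t.word.length + (Forest.node ts).word.length) + ·) := by
  rw [Forest.rootFrontier]
  have h1 : (t :: (ts ++ [s])).dropLast = t :: ts := by
    rw [← List.cons_append, List.dropLast_concat]
  have h2 : (t :: (ts ++ [s])).getLast (List.cons_ne_nil _ _) = s := by
    simp
  rw [h1, h2]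
  simp [Forest.word]

end Forests

/-! ### Subwords whose letters keep their contexts -/

section Restrict

variable {A : Type u} {M : Type v} [Monoid M] (μ : FreeMonoid A →* M)

lemma restrict_append (u v : List A) (I J : Finset ℕ) (hI : ∀ i ∈ I, i < u.length) :
    restrict (u ++ v) (I ∪ J.image (u.length + ·)) = restrict u I ++ restrict v J := by
  have h1 : (u.zipIdx.filter fun a => a.2 ∈ I ∪ J.image (u.length + ·)) =
      u.zipIdx.filter fun a => a.2 ∈ I := by
    refine List.filter_congr fun a ha => ?_
    have := List.snd_lt_of_mem_zipIdx ha
    simp only [Finset.mem_union, Finset.mem_image, decide_eq_decide, or_iff_left_iff_imp]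
    rintro ⟨j, -, hj⟩
    omega
  have h2 : ((v.zipIdx u.length).filter fun a => a.2 ∈ I ∪ J.image (u.length + ·)).map Prod.fst =
      (v.zipIdx.filter fun a => a.2 ∈ J).map Prod.fst := by
    rw [List.zipIdx_eq_map_add, List.filter_map, List.map_map]
    congr 1
    refine List.filter_congr fun a ha => ?_
    simp only [Function.comp_apply, Finset.mem_union, Finset.mem_image, decide_eq_decide]
    constructor
    · rintro (h | ⟨j, hj, hja⟩)
      · have := hI _ h
        omega
      · obtain rfl : j = a.2 := by omega
        exact hj
    · exact fun h => .inr ⟨_, h, by omega⟩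
  rw [restrict, List.zipIdx_append, List.filter_append, List.map_append, h1, Nat.zero_add, h2]
  rfl

lemma restrict_empty (u : List A) : restrict u ∅ = [] := by simp [restrict]

/-- The sum of `f p a q` over the decompositions `u = u' a u''` such that the position of `a` is
in `I`, where `p` and `q` are the values of `u'` and `u''`. -/
def posSum (u : List A) (I : Finset ℕ) (f : M → A → M → ℕ) : ℕ :=
  ∑ i ∈ I, u[i]?.elim 0 fun a => f (val μ (u.take i)) a (val μ (u.drop (i + 1)))

lemma posSum_append (u x v : List A) (I J : Finset ℕ) (hI : ∀ i ∈ I, i < u.length)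
    (f : M → A → M → ℕ) :
    posSum μ (u ++ (x ++ v)) (I ∪ J.image ((u.length + x.length) + ·)) f =
      posSum μ u I (fun p a q => f p a (q * (val μ x * val μ v))) +
        posSum μ v J (fun p a q => f (val μ u * val μ x * p) a q) := by
  rw [posSum, Finset.sum_union, Finset.sum_image]
  · congr 1
    · refine Finset.sum_congr rfl fun i hi => ?_
      have := hI i hi
      rw [List.getElem?_append_left this, List.take_append_of_le_length this.le,
        List.drop_append_of_le_length this]
      simp
    · refine Finset.sum_congr rfl fun i _ => ?_
      have h : u ++ (x ++ v) = (u ++ x) ++ v := by simp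
      rw [h, ← List.length_append, List.getElem?_append_right (by omega), add_assoc,
        List.take_length_add_append, List.drop_length_add_append]
      simp [mul_assoc]
  · intro a _ b _ h
    simpa using h
  · rw [Finset.disjoint_left]
    intro i hi hj
    have := hI i hi
    obtain ⟨j, -, rfl⟩ := Finset.mem_image.1 hj
    omega

/-- The positions of `I` in `u` have the same letters and the same contexts as all the positions
of `u'`. -/
structure SameContexts (u : List A) (I : Finset ℕ) (u' : List A) : Prop where
  lt_length : ∀ i ∈ I, i < u.length
  val_eq : val μ u = val μ u'
  sum_eq : ∀ f : M → A → M → ℕ, posSum μ u I f = posSum μ u' (Finset.range u'.length) f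

variable {μ}

lemma sameContexts_range (u : List A) : SameContexts μ u (Finset.range u.length) u :=
  ⟨by simp, rfl, fun _ => rfl⟩

/-- The middle word `x` carries no selected position and its value is absorbed by both neighbours,
so the selected letters of `u` and `v` cannot detect its deletion. -/
lemma SameContexts.append {u x v u' v' : List A} {I J : Finset ℕ} (hu : SameContexts μ u I u')
    (hv : SameContexts μ v J v') (hx : val μ u * val μ x = val μ u)
    (hx' : val μ x * val μ v = val μ v) :
    SameContexts μ (u ++ (x ++ v)) (I ∪ J.image ((u.length + x.length) + ·)) (u' ++ v') where
  lt_length i hi := by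
    rcases Finset.mem_union.1 hi with hi | hi
    · have := hu.lt_length i hi
      simp
      omega
    · obtain ⟨j, hj, rfl⟩ := Finset.mem_image.1 hi
      have := hv.lt_length j hj
      simp
      omega
  val_eq := by rw [val_append, val_append, val_append, hx', hu.val_eq, hv.val_eq]
  sum_eq f := by
    -- The word `u' ++ v'` is treated as the same configuration with an empty middle word.
    have h := posSum_append μ u' [] v' (Finset.range u'.length) (Finset.range v'.length)
      (by simp) f
    have hr : Finset.range (u' ++ v').length = Finset.range u'.length ∪
        (Finset.range v'.length).image ((u'.length + ([] : List A).length) + ·) := by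
      ext i
      simp only [List.length_append, Finset.mem_range, List.length_nil, add_zero,
        Finset.mem_union, Finset.mem_image]
      constructor
      · intro hi
        by_cases hi' : i < u'.length
        · exact .inl hi'
        · exact .inr ⟨i - u'.length, by omega, by omega⟩
      · rintro (hi | ⟨j, hj, rfl⟩) <;> omega
    rw [← hr] at h
    rw [posSum_append μ u x v I J hu.lt_length, hu.sum_eq, hv.sum_eq, hx, hx', hu.val_eq, hv.val_eq]
    simpa using h.symm

end Restrict

/-! ### The frontier word of a factorization forest -/

section Factorizations

variable {A : Type u} {M : Type v} [Monoid M] {μ : FreeMonoid A →* M}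

lemma IsFactorization.of_sublist {ts ts' : List (Forest A)} (h : IsFactorization μ (.node ts))
    (hs : ts'.Sublist ts) : IsFactorization μ (.node ts') := by
  cases h with
  | node _ hts hne hidem =>
    refine .node _ (fun t ht => hts t (hs.subset ht)) (fun t ht => hne t (hs.subset ht)) fun hl => ?_
    obtain ⟨e, he, h⟩ := hidem (hl.trans hs.length_le)
    exact ⟨e, he, fun t ht => h t (hs.subset ht)⟩

lemma IsFactorization.of_mem {t : Forest A} {ts : List (Forest A)}
    (h : IsFactorization μ (.node ts)) (ht : t ∈ ts) : IsFactorization μ t := by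
  cases h with
  | node _ hts hne hidem => exact hts t ht

lemma IsFactorization.exists_idempotent {ts : List (Forest A)}
    (h : IsFactorization μ (.node ts)) (hl : 3 ≤ ts.length) :
    ∃ e : M, IsIdempotentElem e ∧ ∀ t ∈ ts, val μ t.word = e := by
  cases h with
  | node _ hts hne hidem => exact hidem hl

lemma val_word_eq_of_forall {ts : List (Forest A)} {e : M} (he : IsIdempotentElem e)
    (h : ∀ t ∈ ts, val μ t.word = e) (hne : ts ≠ []) : val μ (Forest.node ts).word = e := by
  induction ts with
  | nil => exact absurd rfl hne
  | cons t ts ih =>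
    rw [Forest.word_cons, val_append, h t (by simp)]
    by_cases hts : ts = []
    · simp [hts, Forest.word_nil]
    · rw [ih (fun s hs => h s (by simp [hs])) hts, he.eq]

/-- Either there are no middle children, or there are at least three children and all the values are
one idempotent. -/
lemma val_cons_concat {t s : Forest A} {ts : List (Forest A)}
    (h : IsFactorization μ (.node (t :: (ts ++ [s])))) :
    val μ t.word * val μ (Forest.node ts).word = val μ t.word ∧
      val μ (Forest.node ts).word * val μ s.word = val μ s.word := by
  by_cases hts : ts = []
  · simp [hts, Forest.word_nil]
  · obtain ⟨e, he, h⟩ := h.exists_idempotent (by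
      have := List.length_pos_iff.2 hts
      simp
      omega)
    rw [val_word_eq_of_forall he (fun t ht => h t (by simp [ht])) hts, h t (by simp),
      h s (by simp), he.eq]
    exact ⟨rfl, rfl⟩

/-- The frontier drops the middle children at every level, and their value is absorbed by the first
and last ones. Hence the frontier word has the value of the full word, and the machine cannot tell
the letters of one from those of the other. -/
lemma sameContexts_rootFrontier {F : Forest A} (hF : IsFactorization μ F) :
    SameContexts μ F.word F.rootFrontier (restrict F.word F.rootFrontier) := by
  induction F using Forest.childInduction with
  | leaf a =>
    have h := sameContexts_range (μ := μ) [a]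
    simpa [Forest.word, Forest.rootFrontier, restrict] using h
  | node ts ih =>
    rcases ts with _ | ⟨t, ts⟩
    · have h := sameContexts_range (μ := μ) []
      simpa [Forest.word, Forest.rootFrontier, restrict] using h
    · rcases List.eq_nil_or_concat ts with rfl | ⟨ts, s, rfl⟩
      · have := ih t (by simp) (hF.of_mem (by simp))
        rwa [Forest.rootFrontier_singleton, Forest.word_cons, Forest.word_nil, List.append_nil]
      · rw [List.concat_eq_append] at *
        have ht := ih t (by simp) (hF.of_mem (by simp))
        have hs := ih s (by simp) (hF.of_mem (by simp))
        obtain ⟨h1, h2⟩ := val_cons_concat hF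
        have := ht.append hs h1 h2
        have hr := restrict_append (t.word ++ (Forest.node ts).word) s.word t.rootFrontier
          s.rootFrontier (fun i hi => by
            have := ht.lt_length i hi
            simp
            omega)
        -- No position of the middle children is selected, so they contribute the empty word.
        have hr' := restrict_append t.word (Forest.node ts).word t.rootFrontier ∅ ht.lt_length
        rw [Finset.image_empty, Finset.union_empty, restrict_empty, List.append_nil] at hr'
        rw [hr', List.append_assoc, List.length_append] at hr
        rw [Forest.rootFrontier_cons_concat, Forest.word_cons, Forest.word_append, Forest.word_cons,
          Forest.word_nil, List.append_nil, hr]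
        exact this

lemma length_restrict_le (u : List A) (I : Finset ℕ) : (restrict u I).length ≤ I.card := by
  rw [restrict, List.length_map]
  have hn : ((u.zipIdx.filter fun a => a.2 ∈ I).map Prod.snd).Nodup := by
    refine (List.Sublist.nodup (List.filter_sublist.map _) ?_)
    rw [List.zipIdx_map_snd]
    exact List.nodup_range'
  rw [← List.length_map (f := Prod.snd), ← List.toFinset_card_of_nodup hn]
  refine Finset.card_le_card fun i hi => ?_
  simp only [List.mem_toFinset, List.mem_map, List.mem_filter, decide_eq_true_eq] at hi
  obtain ⟨a, ⟨-, ha⟩, rfl⟩ := hi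
  exact ha

/-- Only the first and the last child contribute, so each level at most doubles the count; this is
the origin of the bound `2 ^ h` on marked words. -/
lemma card_rootFrontier_le (F : Forest A) : F.rootFrontier.card ≤ 2 ^ F.height := by
  induction F using Forest.childInduction with
  | leaf a => simp [Forest.rootFrontier, Forest.height]
  | node ts ih =>
    rcases ts with _ | ⟨t, ts⟩
    · simp [Forest.rootFrontier]
    · have key : ∀ s ∈ t :: ts, 2 * s.rootFrontier.card ≤ 2 ^ (Forest.node (t :: ts)).height := by
        intro s hs
        calc 2 * s.rootFrontier.card ≤ 2 ^ (s.height + 1) := by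
              rw [pow_succ']
              exact Nat.mul_le_mul_left 2 (ih s hs)
          _ ≤ _ := Nat.pow_le_pow_right (by simp) (Forest.height_le_of_mem hs)
      rcases List.eq_nil_or_concat ts with rfl | ⟨ts, s, rfl⟩
      · have := key t (by simp)
        rw [Forest.rootFrontier_singleton]
        omega
      · rw [List.concat_eq_append] at *
        have h1 := key t (by simp)
        have h2 := key s (by simp)
        rw [Forest.rootFrontier_cons_concat]
        refine (Finset.card_union_le _ _).trans ?_
        have := Finset.card_image_le (s := s.rootFrontier)
          (f := ((t.word.length + (Forest.node ts).word.length) + ·))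
        omega

end Factorizations

/-! ### Linearizations and their erasures -/

section Linearizations

variable {A : Type u} {M : Type v} [Monoid M] (μ : FreeMonoid A →* M)

open Multicontext

lemma lin_empty (F : Forest A) : lin μ F ∅ = .elem (val μ F.word) := by
  rw [lin.eq_def]; simp

lemma lin_root (F : Forest A) : lin μ F {[]} = .mark (restrict F.word F.rootFrontier) := by
  rw [lin.eq_def]; simp

lemma lin_node {ts : List (Forest A)} {T : Finset (List ℕ)} (hT : T ≠ ∅) (hT' : T ≠ {[]}) :
    lin μ (.node ts) T = (List.ofFn fun j : Fin ts.length => lin μ ts[j] (childNodes T j)).prod := by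
  rw [lin.eq_def]; simp [hT, hT']

/-- The value of a node is the product of the values of its children, so the recursive clause also
covers `T = ∅` and later inductions need no separate case. -/
lemma lin_node_of_notMem {ts : List (Forest A)} {T : Finset (List ℕ)} (hT : [] ∉ T) :
    lin μ (.node ts) T = (List.ofFn fun j : Fin ts.length => lin μ ts[j] (childNodes T j)).prod := by
  by_cases h : T = ∅
  · subst h
    simp only [lin_empty, childNodes_empty]
    clear hT
    induction ts with
    | nil => simp [Forest.word, one_def]
    | cons t ts ih =>
      rw [Forest.word_cons, val_append, ← elem_mul_elem, ih]
      simp [List.ofFn_succ]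
  · exact lin_node μ h (by rintro rfl; simp at hT)

lemma lin_nil {T : Finset (List ℕ)} (hT : [] ∉ T) : lin μ (.node []) T = 1 := by
  rw [lin_node_of_notMem μ hT]; simp

lemma lin_cons (t : Forest A) (ts : List (Forest A)) {T : Finset (List ℕ)} (hT : [] ∉ T) :
    lin μ (.node (t :: ts)) T = lin μ t (childNodes T 0) * lin μ (.node ts) (tailNodes T) := by
  rw [lin_node_of_notMem μ hT, lin_node_of_notMem μ (T := tailNodes T) (by simpa using hT)]
  simp [List.ofFn_succ, childNodes_tailNodes]

lemma lin_concat (t : Forest A) (ts : List (Forest A)) {T : Finset (List ℕ)} (hT : [] ∉ T) :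
    lin μ (.node (ts ++ [t])) T =
      lin μ (.node ts) (T.filter fun p => p.head? ≠ some ts.length) *
        lin μ t (childNodes T ts.length) := by
  induction ts generalizing T with
  | nil =>
    rw [List.nil_append, lin_cons μ _ _ hT, lin_nil μ (by simpa using hT), lin_nil μ (by simp [hT])]
    simp
  | cons s ts ih =>
    rw [List.cons_append, lin_cons μ _ _ hT, ih (by simpa using hT), lin_cons μ _ _ (by simp [hT]),
      childNodes_tailNodes, mul_assoc]
    congr 2
    · ext p; simp
    · congr 1
      ext p
      cases p <;> simp [shiftPath]

/-- A marked word is a frontier word and has the value of the subforest it stands for. -/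
lemma value_lin {F : Forest A} (hF : IsFactorization μ F) (T : Finset (List ℕ)) :
    value μ (lin μ F T) = val μ F.word := by
  induction F using Forest.consInduction generalizing T with
  | leaf a =>
    by_cases hT' : T = {[]}
    · subst hT'
      rw [lin_root, value_mark, ← (sameContexts_rootFrontier hF).val_eq]
    · rw [lin.eq_def]; by_cases hT : T = ∅ <;> simp [hT, hT', Forest.word]
  | nil =>
    by_cases hT' : T = {[]}
    · subst hT'
      rw [lin_root, value_mark, ← (sameContexts_rootFrontier hF).val_eq]
    · rw [lin.eq_def]; by_cases hT : T = ∅ <;> simp [hT, hT', Forest.word]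
  | cons t ts iht ihts =>
    by_cases hT' : T = {[]}
    · subst hT'
      rw [lin_root, value_mark, ← (sameContexts_rootFrontier hF).val_eq]
    by_cases hT : T = ∅
    · rw [hT, lin_empty, value_elem]
    -- For an arbitrary `T` the root may occur together with other nodes; the recursion on children
    -- then ignores it.
    have h : lin μ (.node (t :: ts)) T = lin μ (.node (t :: ts)) (T.erase []) := by
      rw [lin_node μ hT hT', lin_node_of_notMem μ (by simp)]
      congr 3
      ext j
      congr 1
      ext; simp
    rw [h, lin_cons μ _ _ (by simp), value_mul, iht (hF.of_mem (by simp)),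
      ihts (hF.of_sublist (by simp)), Forest.word_cons, val_append]

/-- The elements of `T` are nodes of `F`, none of which is an ancestor of another one. -/
structure IsAntichainOfNodes (F : Forest A) (T : Finset (List ℕ)) : Prop where
  exists_subforest : ∀ p ∈ T, (F.subforest p).isSome
  eq_of_prefix : ∀ p ∈ T, ∀ q ∈ T, p <+: q → p = q

namespace IsAntichainOfNodes

variable {F : Forest A} {T : Finset (List ℕ)}

lemma nil_notMem (h : IsAntichainOfNodes F T) (hT : T ≠ {[]}) : [] ∉ T := by
  intro hn
  refine hT (Finset.eq_singleton_iff_unique_mem.2 ⟨hn, fun p hp => ?_⟩)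
  exact (h.eq_of_prefix _ hn _ hp (List.nil_prefix)).symm

lemma childNodes {t : Forest A} {ts : List (Forest A)}
    (h : IsAntichainOfNodes (.node (t :: ts)) T) : IsAntichainOfNodes t (childNodes T 0) where
  exists_subforest p hp := by
    simpa [Forest.subforest] using h.exists_subforest _ (mem_childNodes.1 hp)
  eq_of_prefix p hp q hq hpq := by
    simpa using h.eq_of_prefix _ (mem_childNodes.1 hp) _ (mem_childNodes.1 hq)
      ((List.prefix_cons_inj 0).2 hpq)

lemma tailNodes {t : Forest A} {ts : List (Forest A)}
    (h : IsAntichainOfNodes (.node (t :: ts)) T) : IsAntichainOfNodes (.node ts) (tailNodes T) where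
  exists_subforest p hp := by
    have := h.exists_subforest _ (mem_tailNodes.1 hp)
    cases p with
    | nil => simp [Forest.subforest]
    | cons j p => simpa [Forest.subforest, shiftPath] using this
  eq_of_prefix p hp q hq hpq := by
    refine shiftPath_injective (h.eq_of_prefix _ (mem_tailNodes.1 hp) _ (mem_tailNodes.1 hq) ?_)
    cases p <;> cases q <;> simp_all [shiftPath, List.cons_prefix_cons]

lemma eq_empty_of_leaf {a : A} (h : IsAntichainOfNodes (.leaf a) T) (hT : T ≠ {[]}) : T = ∅ := by
  refine Finset.eq_empty_iff_forall_notMem.2 fun p hp => ?_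
  cases p with
  | nil => exact h.nil_notMem hT hp
  | cons j p => simpa [Forest.subforest] using h.exists_subforest _ hp

lemma eq_empty_of_nil (h : IsAntichainOfNodes (.node [] : Forest A) T) (hT : T ≠ {[]}) :
    T = ∅ := by
  refine Finset.eq_empty_iff_forall_notMem.2 fun p hp => ?_
  cases p with
  | nil => exact h.nil_notMem hT hp
  | cons j p => simpa [Forest.subforest] using h.exists_subforest _ hp

end IsAntichainOfNodes

lemma childNodes_singleton (p : List ℕ) : childNodes {0 :: p} 0 = {p} := by ext; simp

lemma tailNodes_singleton (p : List ℕ) : tailNodes {0 :: p} = ∅ := by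
  ext q; cases q <;> simp [shiftPath]

lemma childNodes_singleton_shiftPath (p : List ℕ) : childNodes {shiftPath p} 0 = ∅ := by
  ext; cases p <;> simp [shiftPath]

lemma tailNodes_singleton_shiftPath (p : List ℕ) : tailNodes {shiftPath p} = {p} := by
  ext q
  simp [shiftPath_injective.eq_iff]

/-- Erasing the mark of a node leaves the value of its subforest, which is what the linearization
shows where nothing is marked. Thus the multiset stored in an architecture determines the erasures,
up to order. -/
theorem coe_singles_lin {F : Forest A} (hF : IsFactorization μ F) {T : Finset (List ℕ)}
    (hT : IsAntichainOfNodes F T) :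
    (singles μ (lin μ F T) : Multiset (Multicontext A M)) = T.val.map fun p => lin μ F {p} := by
  induction F using Forest.consInduction generalizing T with
  | leaf a =>
    by_cases hT' : T = {[]}
    · simp [hT', lin_root, singles_mark]
    · simp [hT.eq_empty_of_leaf hT', lin_empty, singles]
  | nil =>
    by_cases hT' : T = {[]}
    · simp [hT', lin_root, singles_mark]
    · simp [hT.eq_empty_of_nil hT', lin_empty, singles]
  | cons t ts iht ihts =>
    by_cases hT' : T = {[]}
    · simp [hT', lin_root, singles_mark]
    have hn := hT.nil_notMem hT'
    have hFt : IsFactorization μ t := hF.of_mem (by simp)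
    have hFts : IsFactorization μ (.node ts) := hF.of_sublist (by simp)
    rw [lin_cons μ _ _ hn, singles_mul, ← Multiset.coe_add, ← Multiset.map_coe, ← Multiset.map_coe,
      iht hFt hT.childNodes, ihts hFts hT.tailNodes, value_lin μ hFt, value_lin μ hFts,
      val_eq_childNodes_add_tailNodes hn, Multiset.map_add, Multiset.map_map, Multiset.map_map,
      Multiset.map_map, Multiset.map_map]
    congr 1
    · refine Multiset.map_congr rfl fun p _ => ?_
      simp only [Function.comp_apply]
      rw [lin_cons μ _ _ (by simp), childNodes_singleton, tailNodes_singleton, lin_empty]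
    · refine Multiset.map_congr rfl fun p hp => ?_
      simp only [Function.comp_apply]
      have hp' : p ≠ [] := by
        rintro rfl
        exact hn (by simpa using hp)
      rw [lin_cons μ _ _ (by cases p <;> simp_all [shiftPath]), childNodes_singleton_shiftPath,
        tailNodes_singleton_shiftPath, lin_empty]

end Linearizations

/-! ### Independent sets and their restriction to children -/

section Independence

variable {A : Type u}

lemma Forest.not_isIterable_nil (F : Forest A) : ¬ F.IsIterable [] := by
  rintro ⟨q, j, ts, h, -⟩
  simp at h

lemma Forest.isIterable_cons {ts : List (Forest A)} {j : ℕ} {p : List ℕ} :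
    (Forest.node ts).IsIterable (j :: p) ↔
      (p = [] ∧ 1 ≤ j ∧ j + 1 < ts.length) ∨ ∃ t, ts[j]? = some t ∧ t.IsIterable p := by
  constructor
  · rintro ⟨q, i, ts', h, hq, h1, h2⟩
    cases q with
    | nil =>
      simp only [List.nil_append, List.cons.injEq] at h
      simp only [Forest.subforest, Option.some.injEq, Forest.node.injEq] at hq
      obtain ⟨rfl, rfl⟩ := h
      subst hq
      exact .inl ⟨rfl, h1, h2⟩
    | cons j' q =>
      simp only [List.cons_append, List.cons.injEq] at h
      obtain ⟨rfl, rfl⟩ := h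
      simp only [Forest.subforest, Option.bind_eq_some_iff] at hq
      obtain ⟨t, ht, hq⟩ := hq
      exact .inr ⟨t, ht, q, i, ts', rfl, hq, h1, h2⟩
  · rintro (⟨rfl, h1, h2⟩ | ⟨t, ht, q, i, ts', rfl, hq, h1, h2⟩)
    · exact ⟨[], j, ts, rfl, by simp [Forest.subforest], h1, h2⟩
    · exact ⟨j :: q, i, ts', rfl, by simp [Forest.subforest, ht, hq], h1, h2⟩

/-- Independent sets of nodes, without a condition on their cardinality. -/
structure Indep (F : Forest A) (T : Finset (List ℕ)) : Prop where
  iterable : ∀ t ∈ T, F.IsIterable t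
  not_prefix : ∀ t ∈ T, ∀ t' ∈ T, t ≠ t' → ¬ t <+: t'
  not_sibling : ∀ t ∈ T, ∀ t' ∈ T, t ≠ t' → ∀ s, AreSiblings t s → ¬ s <+: t'

lemma IsIndependent.indep {F : Forest A} {x : ℕ} {T : Finset (List ℕ)} (h : IsIndependent F x T) :
    Indep F T :=
  ⟨h.2.1, fun t ht t' ht' hne => (h.2.2 t ht t' ht' hne).1,
    fun t ht t' ht' hne => (h.2.2 t ht t' ht' hne).2⟩

lemma AreSiblings.cons {p s : List ℕ} (h : AreSiblings p s) (j : ℕ) :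
    AreSiblings (j :: p) (j :: s) := by
  obtain ⟨q, i, ⟨rfl, rfl⟩ | ⟨rfl, rfl⟩⟩ := h
  · exact ⟨j :: q, i, .inl ⟨rfl, rfl⟩⟩
  · exact ⟨j :: q, i, .inr ⟨rfl, rfl⟩⟩

lemma AreSiblings.shiftPath {p s : List ℕ} (h : AreSiblings p s) :
    AreSiblings (shiftPath p) (shiftPath s) := by
  obtain ⟨q, i, ⟨rfl, rfl⟩ | ⟨rfl, rfl⟩⟩ := h <;> cases q with
  | nil => exact ⟨[], i + 1, by simp [MarbleArch.shiftPath]⟩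
  | cons j q => exact ⟨(j + 1) :: q, i, by simp [MarbleArch.shiftPath]⟩

lemma shiftPath_prefix {p q : List ℕ} (h : p <+: q) : shiftPath p <+: shiftPath q := by
  cases p <;> cases q <;> simp_all [shiftPath, List.cons_prefix_cons]

namespace Indep

variable {F : Forest A} {T : Finset (List ℕ)} {ts : List (Forest A)}

lemma nil_notMem (h : Indep F T) : [] ∉ T :=
  fun hn => F.not_isIterable_nil (h.iterable _ hn)

lemma ne_root (h : Indep F T) : T ≠ {[]} := by
  rintro rfl
  exact h.nil_notMem (by simp)

lemma isAntichainOfNodes (h : Indep F T) : IsAntichainOfNodes F T where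
  exists_subforest p hp := by
    obtain ⟨q, j, ts, rfl, hq, h1, h2⟩ := h.iterable p hp
    clear hp h
    induction q generalizing F with
    | nil =>
      simp only [Forest.subforest, Option.some.injEq] at hq
      subst hq
      simp [Forest.subforest]
      omega
    | cons i q ih =>
      cases F with
      | leaf a => simp [Forest.subforest] at hq
      | node ts' =>
        simp only [Forest.subforest, Option.bind_eq_some_iff] at hq
        obtain ⟨t, ht, hq⟩ := hq
        simpa [Forest.subforest, ht] using ih hq
  eq_of_prefix p hp q hq hpq := by
    by_contra hne
    exact h.not_prefix p hp q hq hne hpq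

lemma eq_empty_of_leaf {a : A} (h : Indep (.leaf a) T) : T = ∅ :=
  h.isAntichainOfNodes.eq_empty_of_leaf h.ne_root

lemma eq_empty_of_nil (h : Indep (.node [] : Forest A) T) : T = ∅ :=
  h.isAntichainOfNodes.eq_empty_of_nil h.ne_root

lemma childNodes_eq (h : Indep F T) {j : ℕ} (hj : [j] ∈ T) : childNodes T j = {[]} := by
  ext p
  simp only [mem_childNodes, Finset.mem_singleton]
  refine ⟨fun hp => ?_, by rintro rfl; exact hj⟩
  have := h.isAntichainOfNodes.eq_of_prefix _ hj _ hp (by simp)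
  simpa using this.symm

lemma childNodes_succ (h : Indep F T) {j : ℕ} (hj : [j] ∈ T) : childNodes T (j + 1) = ∅ :=
  childNodes_eq_empty_iff.2 fun p hp => h.not_sibling _ hj _ hp (by simp) [j + 1]
    ⟨[], j, .inl ⟨rfl, rfl⟩⟩ (by simp)

lemma childNodes_pred (h : Indep F T) {j : ℕ} (hj : [j + 1] ∈ T) : childNodes T j = ∅ :=
  childNodes_eq_empty_iff.2 fun p hp => h.not_sibling _ hj _ hp (by simp) [j]
    ⟨[], j, .inr ⟨rfl, rfl⟩⟩ (by simp)

lemma bounds_of_mem (h : Indep (.node ts) T) {j : ℕ} (hj : [j] ∈ T) :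
    1 ≤ j ∧ j + 1 < ts.length := by
  rcases Forest.isIterable_cons.1 (h.iterable _ hj) with h | ⟨t, -, ht⟩
  · exact h.2
  · exact absurd ht t.not_isIterable_nil

lemma lt_length (h : Indep (.node ts) T) {j : ℕ} {p : List ℕ} (hp : j :: p ∈ T) :
    j < ts.length := by
  rcases Forest.isIterable_cons.1 (h.iterable _ hp) with h | ⟨t, ht, -⟩
  · omega
  · exact (List.getElem?_eq_some_iff.1 ht).1

lemma child (h : Indep (.node ts) T) {j : ℕ} {t : Forest A} (ht : ts[j]? = some t)
    (hj : [j] ∉ T) : Indep t (childNodes T j) where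
  iterable p hp := by
    rw [mem_childNodes] at hp
    rcases Forest.isIterable_cons.1 (h.iterable _ hp) with ⟨rfl, -⟩ | ⟨t', ht', h'⟩
    · exact absurd hp hj
    · rw [ht] at ht'
      cases ht'
      exact h'
  not_prefix p hp q hq hne hpq := by
    rw [mem_childNodes] at hp hq
    exact h.not_prefix _ hp _ hq (by simpa using hne) ((List.prefix_cons_inj j).2 hpq)
  not_sibling p hp q hq hne s hs hsq := by
    rw [mem_childNodes] at hp hq
    exact h.not_sibling _ hp _ hq (by simpa using hne) _ (hs.cons j)
      ((List.prefix_cons_inj j).2 hsq)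

lemma first {t : Forest A} (h : Indep (.node (t :: ts)) T) : Indep t (childNodes T 0) :=
  h.child (by simp) fun h0 => by simpa using h.bounds_of_mem h0

lemma last {t : Forest A} (h : Indep (.node (ts ++ [t])) T) :
    Indep t (childNodes T ts.length) :=
  h.child (by simp) fun h0 => by simpa using h.bounds_of_mem h0

/-- Removing `F_1` turns the second child into a first one, which is no longer iterable. That child
is not in `T`, because its left sibling contains nodes of `T`. -/
lemma tail {t : Forest A} (h : Indep (.node (t :: ts)) T) (h0 : childNodes T 0 ≠ ∅) :
    Indep (.node ts) (tailNodes T) where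
  iterable p hp := by
    rw [mem_tailNodes] at hp
    cases p with
    | nil => exact absurd hp h.nil_notMem
    | cons j p =>
      have h1 : [1] ∉ T := fun h1 => h0 (h.childNodes_pred h1)
      rcases Forest.isIterable_cons.1 (h.iterable _ hp) with ⟨rfl, -, hj⟩ | ⟨t', ht', h'⟩
      · refine Forest.isIterable_cons.2 (.inl ⟨rfl, ?_, by simpa using hj⟩)
        rcases j with _ | j
        · exact absurd hp h1
        · omega
      · exact Forest.isIterable_cons.2 (.inr ⟨t', by simpa using ht', h'⟩)
  not_prefix p hp q hq hne hpq := by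
    rw [mem_tailNodes] at hp hq
    exact h.not_prefix _ hp _ hq (shiftPath_injective.ne hne) (shiftPath_prefix hpq)
  not_sibling p hp q hq hne s hs hsq := by
    rw [mem_tailNodes] at hp hq
    exact h.not_sibling _ hp _ hq (shiftPath_injective.ne hne) _ hs.shiftPath
      (shiftPath_prefix hsq)

/-- Mirror image of `tail`: the child that becomes last is not in `T`, because its right sibling
contains nodes of `T`. -/
lemma init {t : Forest A} (h : Indep (.node (ts ++ [t])) T)
    (hn : childNodes T ts.length ≠ ∅) :
    Indep (.node ts) (T.filter fun p => p.head? ≠ some ts.length) where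
  iterable p hp := by
    rw [Finset.mem_filter] at hp
    obtain ⟨hp, hne⟩ := hp
    cases p with
    | nil => exact absurd hp h.nil_notMem
    | cons j p =>
      have hlt := h.lt_length hp
      simp only [List.head?_cons, ne_eq, Option.some.injEq] at hne
      simp only [List.length_append, List.length_singleton] at hlt
      rcases Forest.isIterable_cons.1 (h.iterable _ hp) with ⟨rfl, h1, hj⟩ | ⟨t', ht', h'⟩
      · refine Forest.isIterable_cons.2 (.inl ⟨rfl, h1, ?_⟩)
        by_contra hcon
        obtain h2 : ts.length = j + 1 := by omega
        exact hn (h2 ▸ h.childNodes_succ hp)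
      · rw [List.getElem?_append_left (by omega)] at ht'
        exact Forest.isIterable_cons.2 (.inr ⟨t', ht', h'⟩)
  not_prefix p hp q hq := h.not_prefix p (Finset.mem_filter.1 hp).1 q (Finset.mem_filter.1 hq).1
  not_sibling p hp q hq := h.not_sibling p (Finset.mem_filter.1 hp).1 q (Finset.mem_filter.1 hq).1

end Indep

lemma card_eq_filter_add_childNodes (T : Finset (List ℕ)) (n : ℕ) :
    T.card = (T.filter fun p => p.head? ≠ some n).card + (childNodes T n).card := by
  have h : (childNodes T n).card = (T.filter fun p => ¬ p.head? ≠ some n).card := by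
    rw [← Finset.card_image_of_injective _ (List.cons_injective (a := n))]
    congr 1
    ext p
    cases p with
    | nil => simp
    | cons j p =>
      simp only [Finset.mem_image, mem_childNodes, List.cons.injEq, Finset.mem_filter,
        List.head?_cons, ne_eq, Option.some.injEq, not_not]
      constructor
      · rintro ⟨q, hq, rfl, rfl⟩
        exact ⟨hq, rfl⟩
      · rintro ⟨hp, rfl⟩
        exact ⟨p, hp, rfl, rfl⟩
  rw [h, Finset.card_filter_add_card_filter_not]

end Independence

/-! ### Linearizations of independent sets are iterators -/

section IteratorLinearizations

variable {A : Type u} {M : Type v} [Monoid M] (μ : FreeMonoid A →* M)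

open Multicontext

/-- Conditions on the nodes `T` of `⟨F_1⟩ ⋯ ⟨F_n⟩` which hold for independent sets and are preserved
when `F_1` is removed. -/
structure Spaced (K : ℕ) (e : M) (ts : List (Forest A)) (T : Finset (List ℕ)) : Prop where
  nil_notMem : [] ∉ T
  lt_length : ∀ j p, j :: p ∈ T → j < ts.length
  iter : ∀ j t, ts[j]? = some t → [j] ∉ T →
    Iter μ K (childNodes T j).card (lin μ t (childNodes T j))
  eq_root : ∀ j, [j] ∈ T → childNodes T j = {[]}
  succ_lt : ∀ j, [j] ∈ T → j + 1 < ts.length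
  succ_empty : ∀ j, [j] ∈ T → childNodes T (j + 1) = ∅
  pred_empty : ∀ j, [j + 1] ∈ T → childNodes T j = ∅
  val_eq : ∀ j, [j] ∈ T → ∀ t ∈ ts, val μ t.word = e ∧
    val μ (restrict t.word t.rootFrontier) = e ∧ (restrict t.word t.rootFrontier).length ≤ K

variable {μ}

lemma Spaced.tail {K : ℕ} {e : M} {t : Forest A} {ts : List (Forest A)} {T : Finset (List ℕ)}
    (h : Spaced μ K e (t :: ts) T) : Spaced μ K e ts (tailNodes T) where
  nil_notMem := by simpa using h.nil_notMem
  lt_length j p hp := by simpa using h.lt_length (j + 1) p (by simpa [shiftPath] using hp)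
  iter j s hs hj := by
    rw [childNodes_tailNodes]
    exact h.iter (j + 1) s (by simpa using hs) (by simpa [shiftPath] using hj)
  eq_root j hj := by
    rw [childNodes_tailNodes]
    exact h.eq_root (j + 1) (by simpa [shiftPath] using hj)
  succ_lt j hj := by simpa using h.succ_lt (j + 1) (by simpa [shiftPath] using hj)
  succ_empty j hj := by
    rw [childNodes_tailNodes]
    exact h.succ_empty (j + 1) (by simpa [shiftPath] using hj)
  pred_empty j hj := by
    rw [childNodes_tailNodes]
    exact h.pred_empty (j + 1) (by simpa [shiftPath] using hj)
  val_eq j hj s hs := h.val_eq (j + 1) (by simpa [shiftPath] using hj) s (by simp [hs])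

/-- When children are consumed from the left, a marked first child lacks the `e` of its already
removed left sibling. The two alternatives record whether this `e` is owed. -/
lemma Spaced.iter_lin {K : ℕ} {e : M} (he : IsIdempotentElem e) {ts : List (Forest A)}
    {T : Finset (List ℕ)} (h : Spaced μ K e ts T) :
    ([0] ∈ T → Iter μ K T.card (.elem e * lin μ (.node ts) T)) ∧
      ([0] ∉ T → Iter μ K T.card (lin μ (.node ts) T)) := by
  induction ts generalizing T with
  | nil =>
    have hT : T = ∅ := Finset.eq_empty_iff_forall_notMem.2 fun p hp => by
      cases p with
      | nil => exact h.nil_notMem hp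
      | cons j p => simpa using h.lt_length j p hp
    subst hT
    exact ⟨by simp, fun _ => by rw [lin_empty]; exact .elem _⟩
  | cons t ts ih =>
    have ht := ih h.tail
    rw [lin_cons μ _ _ h.nil_notMem, card_eq_childNodes_add_tailNodes h.nil_notMem]
    have h01 : [0] ∈ tailNodes T ↔ [1] ∈ T := by simp [shiftPath]
    rw [h01] at ht
    constructor
    · intro h0
      have h1 : childNodes T 1 = ∅ := h.succ_empty 0 h0
      have h1' : [1] ∉ T := childNodes_eq_empty_iff.1 h1 []
      obtain ⟨-, hu, hK⟩ := h.val_eq 0 h0 t (by simp)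
      have hl := h.succ_lt 0 h0
      rcases ts with _ | ⟨s, ts⟩
      · simp at hl
      have hs := (h.val_eq 0 h0 s (by simp)).1
      -- The next child is unmarked of value `e = e * e`: one copy closes the block on the right,
      -- the other stays in place.
      have hes : .elem e * lin μ (.node (s :: ts)) (tailNodes T) =
          lin μ (.node (s :: ts)) (tailNodes T) := by
        rw [lin_cons μ _ _ h.tail.nil_notMem, childNodes_tailNodes, h1, lin_empty, hs, ← mul_assoc,
          elem_mul_elem, he.eq]
      rw [h.eq_root 0 h0, lin_root, ← hes, Finset.card_singleton, ← mul_assoc, ← mul_assoc]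
      have hm := Iter.mark (μ := μ) (hu.symm ▸ he) hK
      rw [hu] at hm
      exact hm.mul (ht.2 h1')
    · intro h0
      -- If the next child is marked, the current one is free of marks and its value is the owed
      -- `e`.
      by_cases h1 : [1] ∈ T
      · have h0' := h.pred_empty 0 h1
        rw [h0', lin_empty, (h.val_eq 1 h1 t (by simp)).1]
        simpa using ht.1 h1
      · exact (h.iter 0 t (by simp) h0).mul (ht.2 h1)

theorem iter_lin {F : Forest A} (hF : IsFactorization μ F) {h : ℕ} (hh : F.height ≤ h)
    {T : Finset (List ℕ)} (hT : Indep F T) : Iter μ (2 ^ h) T.card (lin μ F T) := by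
  induction F using Forest.childInduction generalizing T with
  | leaf a =>
    rw [hT.eq_empty_of_leaf, lin_empty]
    exact .elem _
  | node ts ih =>
    rw [Forest.height_node_le] at hh
    obtain ⟨e, he, hval⟩ : ∃ e : M, IsIdempotentElem e ∧
        ∀ j, [j] ∈ T → ∀ t ∈ ts, val μ t.word = e := by
      by_cases hl : 3 ≤ ts.length
      · obtain ⟨e, he, h⟩ := hF.exists_idempotent hl
        exact ⟨e, he, fun _ _ => h⟩
      · refine ⟨1, .one, fun j hj => ?_⟩
        have := hT.bounds_of_mem hj
        omega
    have hs : Spaced μ (2 ^ h) e ts T :=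
      { nil_notMem := hT.nil_notMem
        lt_length := fun j p hp => hT.lt_length hp
        iter := fun j t ht hj => by
          have hmem := List.mem_of_getElem? ht
          exact ih t hmem (hF.of_mem hmem) ((Nat.le_succ _).trans (hh t hmem)) (hT.child ht hj)
        eq_root := fun j hj => hT.childNodes_eq hj
        succ_lt := fun j hj => (hT.bounds_of_mem hj).2
        succ_empty := fun j hj => hT.childNodes_succ hj
        pred_empty := fun j hj => hT.childNodes_pred hj
        val_eq := fun j hj t ht => by
          refine ⟨hval j hj t ht, ?_, ?_⟩
          · rw [← (sameContexts_rootFrontier (hF.of_mem ht)).val_eq, hval j hj t ht]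
          · exact (length_restrict_le _ _).trans ((card_rootFrontier_le t).trans
              (Nat.pow_le_pow_right (by simp) ((Nat.le_succ _).trans (hh t ht)))) }
    exact (hs.iter_lin he).2 fun h0 => by simpa using hT.bounds_of_mem h0

end IteratorLinearizations

/-! ### Equal architectures give equal productions -/

section Architectures

variable {A : Type u} {M : Type v} [Monoid M] {μ : FreeMonoid A →* M}

open Multicontext

lemma dropLast_split {t : Forest A} {ts : List (Forest A)} :
    (t :: ts).dropLast ++ [(t :: ts).getLast (List.cons_ne_nil t ts)] = t :: ts :=
  List.dropLast_append_getLast _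

lemma Indep.dropLast {t : Forest A} {ts : List (Forest A)} {T : Finset (List ℕ)}
    (h : Indep (.node (t :: ts)) T) (hn : childNodes T ts.length ≠ ∅) :
    Indep (.node (t :: ts).dropLast) (T.filter fun p => p.head? ≠ some ts.length) := by
  have hl : (t :: ts).dropLast.length = ts.length := by simp
  rw [← dropLast_split] at h
  rw [← hl] at hn ⊢
  exact h.init hn

lemma Indep.getLast {t : Forest A} {ts : List (Forest A)} {T : Finset (List ℕ)}
    (h : Indep (.node (t :: ts)) T) :
    Indep ((t :: ts).getLast (List.cons_ne_nil t ts)) (childNodes T ts.length) := by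
  have hl : (t :: ts).dropLast.length = ts.length := by simp
  rw [← dropLast_split] at h
  rw [← hl]
  exact h.last

lemma lin_dropLast_mul_getLast (t : Forest A) (ts : List (Forest A)) {T : Finset (List ℕ)}
    (hT : [] ∉ T) :
    lin μ (.node (t :: ts)) T =
      lin μ (.node (t :: ts).dropLast) (T.filter fun p => p.head? ≠ some ts.length) *
        lin μ ((t :: ts).getLast (List.cons_ne_nil t ts)) (childNodes T ts.length) := by
  have hl : (t :: ts).dropLast.length = ts.length := by simp
  have := lin_concat μ ((t :: ts).getLast (List.cons_ne_nil t ts)) (t :: ts).dropLast hT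
  rwa [dropLast_split, hl] at this

/-- Marks lie only strictly between the first and last children, so there are at least three
children. The unmarked outer ones contribute the common idempotent at both ends. -/
lemma value_lin_absorb {t : Forest A} {ts : List (Forest A)} {T : Finset (List ℕ)}
    (hF : IsFactorization μ (.node (t :: ts))) (hT : Indep (.node (t :: ts)) T) (hne : T ≠ ∅)
    (h0 : childNodes T 0 = ∅) (hn : childNodes T ts.length = ∅) :
    IsIdempotentElem (value μ (lin μ (.node (t :: ts)) T)) ∧
      .elem (value μ (lin μ (.node (t :: ts)) T)) * lin μ (.node (t :: ts)) T =
        lin μ (.node (t :: ts)) T ∧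
      lin μ (.node (t :: ts)) T * .elem (value μ (lin μ (.node (t :: ts)) T)) =
        lin μ (.node (t :: ts)) T := by
  have hlen : 3 ≤ (t :: ts).length := by
    obtain ⟨p, hp⟩ := Finset.nonempty_iff_ne_empty.2 hne
    cases p with
    | nil => exact absurd hp hT.nil_notMem
    | cons j p =>
      have h1 := hT.lt_length hp
      have h2 : j ≠ 0 := by
        rintro rfl
        exact childNodes_eq_empty_iff.1 h0 p hp
      have h3 : j ≠ ts.length := by
        rintro rfl
        exact childNodes_eq_empty_iff.1 hn p hp
      simp only [List.length_cons] at h1 ⊢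
      omega
  obtain ⟨e, he, h⟩ := hF.exists_idempotent hlen
  rw [value_lin μ hF, val_word_eq_of_forall he h (by simp)]
  refine ⟨he, ?_, ?_⟩
  · rw [lin_cons μ _ _ hT.nil_notMem, h0, lin_empty, h t (by simp), ← mul_assoc, elem_mul_elem,
      he.eq]
  · rw [lin_dropLast_mul_getLast t ts hT.nil_notMem, hn, lin_empty,
      h _ (List.getLast_mem _), mul_assoc, elem_mul_elem, he.eq]

lemma arch_empty (t : Forest A) (ts : List (Forest A)) :
    arch μ (.node (t :: ts)) ∅ = [.value (val μ (Forest.node (t :: ts)).word)] := by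
  rw [arch]; simp

lemma arch_first (t : Forest A) (ts : List (Forest A)) {T : Finset (List ℕ)} (hT : T ≠ ∅)
    (h0 : childNodes T 0 ≠ ∅) : arch μ (.node (t :: ts)) T =
      .nested (arch μ t (childNodes T 0)) :: arch μ (.node ts) (tailNodes T) := by
  rw [arch]; simp [hT, h0]

lemma arch_last (t : Forest A) (ts : List (Forest A)) {T : Finset (List ℕ)} (hT : T ≠ ∅)
    (h0 : childNodes T 0 = ∅) (hn : childNodes T ts.length ≠ ∅) : arch μ (.node (t :: ts)) T =
      arch μ (.node (t :: ts).dropLast) (T.filter fun p => p.head? ≠ some ts.length) ++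
        [.nested (arch μ ((t :: ts).getLast (List.cons_ne_nil t ts)) (childNodes T ts.length))] := by
  rw [arch]; simp [hT, h0, hn]

lemma arch_middle (t : Forest A) (ts : List (Forest A)) {T : Finset (List ℕ)} (hT : T ≠ ∅)
    (h0 : childNodes T 0 = ∅) (hn : childNodes T ts.length = ∅) : arch μ (.node (t :: ts)) T =
      [.types (T.val.map fun p => (lin μ (.node (t :: ts)) {p}, p.length))] := by
  rw [arch]; simp [hT, h0, hn]

/-- Peeling last children only appends symbols on the right, and the leftmost symbol eventually
comes from the empty or the middle clause. Hence a leading nested symbol characterizes the clause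
that splits off the first child. -/
lemma arch_ne_nested_cons {t : Forest A} {ts : List (Forest A)} {T : Finset (List ℕ)}
    (h0 : childNodes T 0 = ∅) : ∃ s l, arch μ (.node (t :: ts)) T = s :: l ∧
      ∀ a, s ≠ .nested a := by
  induction hn : ts.length generalizing ts T with
  | zero =>
    by_cases hT : T = ∅
    · subst hT
      exact ⟨_, _, arch_empty t ts, by simp⟩
    -- With a single child, the first child is also the last one.
    · exact ⟨_, _, arch_middle t ts hT h0 (hn ▸ h0), by simp⟩
  | succ n ih =>
    by_cases hT : T = ∅
    · subst hT
      exact ⟨_, _, arch_empty t ts, by simp⟩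
    by_cases hn' : childNodes T ts.length = ∅
    · exact ⟨_, _, arch_middle t ts hT h0 hn', by simp⟩
    have hts : ts ≠ [] := by
      rintro rfl
      simp at hn
    have hf : childNodes (T.filter fun p => p.head? ≠ some ts.length) 0 = ∅ := by
      rw [childNodes_eq_empty_iff] at h0 ⊢
      exact fun p hp => h0 p (Finset.mem_filter.1 hp).1
    obtain ⟨s, l, hs, hne⟩ := ih (ts := ts.dropLast) hf (by simp [hn])
    refine ⟨s, l ++ [.nested (arch μ ((t :: ts).getLast (List.cons_ne_nil t ts))
      (childNodes T ts.length))], ?_, hne⟩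
    rw [arch_last t ts hT h0 hn', List.dropLast_cons_of_ne_nil hts, hs, List.cons_append]

/-- The alternatives in the definition of the architecture. -/
inductive ArchCases (μ : FreeMonoid A →* M) :
    Forest A → Finset (List ℕ) → List (ArchSymbol A M) → Prop
  | leaf (a : A) (T : Finset (List ℕ)) : ArchCases μ (.leaf a) T [.letter a]
  | nil (T : Finset (List ℕ)) : ArchCases μ (.node []) T []
  | empty (t : Forest A) (ts : List (Forest A)) :
      ArchCases μ (.node (t :: ts)) ∅ [.value (val μ (Forest.node (t :: ts)).word)]
  | first (t : Forest A) (ts : List (Forest A)) (T : Finset (List ℕ)) (hT : T ≠ ∅)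
      (h0 : childNodes T 0 ≠ ∅) : ArchCases μ (.node (t :: ts)) T
        (.nested (arch μ t (childNodes T 0)) :: arch μ (.node ts) (tailNodes T))
  | last (t : Forest A) (ts : List (Forest A)) (T : Finset (List ℕ)) (hT : T ≠ ∅)
      (h0 : childNodes T 0 = ∅) (hn : childNodes T ts.length ≠ ∅)
      (hhead : ∀ a l, arch μ (.node (t :: ts).dropLast)
          (T.filter fun p => p.head? ≠ some ts.length) ++
        [.nested (arch μ ((t :: ts).getLast (List.cons_ne_nil t ts)) (childNodes T ts.length))] ≠
        .nested a :: l) :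
      ArchCases μ (.node (t :: ts)) T
        (arch μ (.node (t :: ts).dropLast) (T.filter fun p => p.head? ≠ some ts.length) ++
        [.nested (arch μ ((t :: ts).getLast (List.cons_ne_nil t ts)) (childNodes T ts.length))])
  | middle (t : Forest A) (ts : List (Forest A)) (T : Finset (List ℕ)) (hT : T ≠ ∅)
      (h0 : childNodes T 0 = ∅) (hn : childNodes T ts.length = ∅) :
      ArchCases μ (.node (t :: ts)) T
        [.types (T.val.map fun p => (lin μ (.node (t :: ts)) {p}, p.length))]

lemma archCases (F : Forest A) (T : Finset (List ℕ)) : ArchCases μ F T (arch μ F T) := by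
  match F with
  | .leaf a => rw [arch]; exact .leaf a T
  | .node [] => rw [arch]; exact .nil T
  | .node (t :: ts) =>
    by_cases hT : T = ∅
    · subst hT
      rw [arch_empty]
      exact .empty t ts
    by_cases h0 : childNodes T 0 = ∅
    · by_cases hn : childNodes T ts.length = ∅
      · rw [arch_middle t ts hT h0 hn]
        exact .middle t ts T hT h0 hn
      · rw [arch_last t ts hT h0 hn]
        refine .last t ts T hT h0 hn fun a l h => ?_
        obtain ⟨s, l', hs, hne⟩ := arch_ne_nested_cons (μ := μ) (t := t) (ts := ts) h0
        rw [← arch_last t ts hT h0 hn, hs] at h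
        exact hne a (List.cons.inj h).1
    · rw [arch_first t ts hT h0]
      exact .first t ts T hT h0

variable {hμ : Function.Surjective μ} {k h : ℕ} {B : MarbleBimachine A M k}

/-- Equality of cardinalities is proved along with the productions: exchanging one factor requires
the number of marks in the other one, which is found in `F` or in `F'` depending on the stage. -/
theorem prod_lin_eq_of_arch_eq (hB : IsPermutable μ hμ B (2 ^ h)) (F : Forest A)
    (T : Finset (List ℕ)) (hF : IsFactorization μ F) (hh : F.height ≤ h) (hT : Indep F T)
    (F' : Forest A) (T' : Finset (List ℕ)) (hF' : IsFactorization μ F') (hh' : F'.height ≤ h)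
    (hT' : Indep F' T') (harch : arch μ F T = arch μ F' T') :
    T.card = T'.card ∧ ∀ (l r : ℕ) (L R : Multicontext A M), l + T.card + r = k →
      Iter μ (2 ^ h) l L → Iter μ (2 ^ h) r R →
      B.prod μ hμ (L * lin μ F T * R) = B.prod μ hμ (L * lin μ F' T' * R) := by
  induction F, T using arch.induct generalizing F' T' with
  | case1 a T =>
    obtain rfl := hT.eq_empty_of_leaf
    rw [arch] at harch
    have hc := archCases (μ := μ) F' T'
    generalize arch μ F' T' = X at hc harch
    cases hc with
    | leaf =>
      obtain rfl := hT'.eq_empty_of_leaf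
      obtain rfl : _ = _ := by simpa using harch
      exact ⟨rfl, fun _ _ _ _ _ _ _ => rfl⟩
    | nil => simp at harch
    | empty => simp at harch
    | first => simp at harch
    -- Here and below, an architecture from the `last` clause is recognized by its final nested
    -- symbol.
    | last => simpa using congrArg List.getLast? harch
    | middle => simp at harch
  | case2 T =>
    obtain rfl := hT.eq_empty_of_nil
    rw [arch] at harch
    have hc := archCases (μ := μ) F' T'
    generalize arch μ F' T' = X at hc harch
    cases hc with
    | nil =>
      obtain rfl := hT'.eq_empty_of_nil
      exact ⟨rfl, fun _ _ _ _ _ _ _ => rfl⟩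
    | leaf => simp at harch
    | empty => simp at harch
    | first => simp at harch
    | last => simpa using congrArg List.getLast? harch
    | middle => simp at harch
  | case3 t ts =>
    rw [arch_empty] at harch
    have hc := archCases (μ := μ) F' T'
    generalize arch μ F' T' = X at hc harch
    cases hc with
    | empty =>
      simp only [List.cons.injEq, ArchSymbol.value.injEq, and_true] at harch
      exact ⟨rfl, fun _ _ _ _ _ _ _ => by rw [lin_empty, lin_empty, harch]⟩
    | leaf => simp at harch
    | nil => simp at harch
    | first => simp at harch
    | last => simpa using congrArg List.getLast? harch
    | middle => simp at harch
  | case4 t ts T hne h0 iht ihts =>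
    rw [arch_first t ts hne h0] at harch
    have hc := archCases (μ := μ) F' T'
    generalize arch μ F' T' = X at hc harch
    cases hc with
    | first t' ts' _ hne' h0' =>
      simp only [List.cons.injEq, ArchSymbol.nested.injEq] at harch
      have hsub (s : Forest A) (l : List (Forest A)) : List.Sublist l (s :: l) := by simp
      have hft := hF.of_mem (t := t) (by simp)
      have hfts := hF.of_sublist (hsub t ts)
      have hft' := hF'.of_mem (t := t') (by simp)
      have hfts' := hF'.of_sublist (hsub t' ts')
      rw [Forest.height_node_le] at hh hh'
      have hht : t.height ≤ h := (Nat.le_succ _).trans (hh t (by simp))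
      have hht' : t'.height ≤ h := (Nat.le_succ _).trans (hh' t' (by simp))
      have hhts := Forest.height_node_le.2 fun s hs => hh s (List.mem_cons_of_mem t hs)
      have hhts' := Forest.height_node_le.2 fun s hs => hh' s (List.mem_cons_of_mem t' hs)
      obtain ⟨hc1, hp1⟩ := iht hft hht hT.first t' _ hft' hht' hT'.first harch.1
      obtain ⟨hc2, hp2⟩ := ihts hfts hhts (hT.tail h0) (.node ts') _ hfts' hhts' (hT'.tail h0')
        harch.2
      rw [card_eq_childNodes_add_tailNodes hT.nil_notMem,
        card_eq_childNodes_add_tailNodes hT'.nil_notMem]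
      refine ⟨by rw [hc1, hc2], fun l r L R hk hL hR => ?_⟩
      rw [lin_cons μ _ _ hT.nil_notMem, lin_cons μ _ _ hT'.nil_notMem]
      -- The first child is exchanged while the rest belongs to the right context; then the rest is
      -- exchanged while the new first child belongs to the left one.
      have e1 := hp1 l _ L _ (by omega) hL ((iter_lin hfts hhts (hT.tail h0)).mul hR)
      have e2 := hp2 _ r _ R (by omega) (hL.mul (iter_lin hft' hht' hT'.first)) hR
      simp only [mul_assoc] at e1 e2 ⊢
      rw [e1, e2]
    | last _ _ _ _ _ _ hhead => exact absurd harch.symm (hhead _ _)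
    | leaf => simp at harch
    | nil => simp at harch
    | empty => simp at harch
    | middle => simp at harch
  | case5 t ts T hne h0 hn iht ihts =>
    have hcF := archCases (μ := μ) (.node (t :: ts)) T
    generalize hY : arch μ (.node (t :: ts)) T = Y at hcF harch
    rw [not_not] at h0
    cases hcF with
    | empty => exact absurd rfl hne
    | first _ _ _ _ h0' => exact absurd h0 h0'
    | middle _ _ _ _ _ hn' => exact absurd hn' hn
    | last _ _ _ _ _ _ hhead =>
      have hc := archCases (μ := μ) F' T'
      generalize arch μ F' T' = X at hc harch
      cases hc with
      | last t' ts' _ hne' h0' hn' =>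
        -- Both sides end with exactly one symbol, so the concatenations split at the same place.
        obtain ⟨ha1, ha2⟩ := List.append_inj' harch rfl
        simp only [List.cons.injEq, ArchSymbol.nested.injEq, and_true] at ha2
        have hm (s : Forest A) (l : List (Forest A)) :
            (s :: l).getLast (List.cons_ne_nil s l) ∈ s :: l := List.getLast_mem _
        have hft := hF.of_mem (hm t ts)
        have hfts := hF.of_sublist (List.dropLast_sublist _)
        have hft' := hF'.of_mem (hm t' ts')
        have hfts' := hF'.of_sublist (List.dropLast_sublist _)
        rw [Forest.height_node_le] at hh hh'
        have hht := (Nat.le_succ _).trans (hh _ (hm t ts))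
        have hht' := (Nat.le_succ _).trans (hh' _ (hm t' ts'))
        have hhts := Forest.height_node_le.2 fun s hs => hh s (List.mem_of_mem_dropLast hs)
        have hhts' := Forest.height_node_le.2 fun s hs => hh' s (List.mem_of_mem_dropLast hs)
        obtain ⟨hc1, hp1⟩ := iht hfts hhts (hT.dropLast hn) _ _ hfts' hhts' (hT'.dropLast hn') ha1
        obtain ⟨hc2, hp2⟩ := ihts hft hht hT.getLast _ _ hft' hht' hT'.getLast ha2
        rw [card_eq_filter_add_childNodes T ts.length, card_eq_filter_add_childNodes T' ts'.length]
        refine ⟨by rw [hc1, hc2], fun l r L R hk hL hR => ?_⟩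
        rw [lin_dropLast_mul_getLast t ts hT.nil_notMem,
          lin_dropLast_mul_getLast t' ts' hT'.nil_notMem]
        have e1 := hp1 l _ L _ (by omega) hL ((iter_lin hft hht hT.getLast).mul hR)
        have e2 := hp2 _ r _ R (by omega) (hL.mul (iter_lin hfts' hhts' (hT'.dropLast hn'))) hR
        simp only [mul_assoc] at e1 e2 ⊢
        rw [e1, e2]
      | first => exact absurd harch (hhead _ _)
      | leaf => simpa using congrArg List.getLast? harch
      | nil => simp at harch
      | empty => simpa using congrArg List.getLast? harch
      | middle => simpa using congrArg List.getLast? harch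
  | case6 t ts T hne h0 hn =>
    rw [not_not] at h0 hn
    rw [arch_middle t ts hne h0 hn] at harch
    have hc := archCases (μ := μ) F' T'
    generalize arch μ F' T' = X at hc harch
    cases hc with
    | middle t' ts' _ hne' h0' hn' =>
      simp only [List.cons.injEq, ArchSymbol.types.injEq, and_true] at harch
      have hs := congrArg (Multiset.map Prod.fst) harch
      simp only [Multiset.map_map, Function.comp_def] at hs
      rw [← coe_singles_lin μ hF hT.isAntichainOfNodes,
        ← coe_singles_lin μ hF' hT'.isAntichainOfNodes, Multiset.coe_eq_coe] at hs
      have hcard : T.card = T'.card := by simpa using congrArg Multiset.card harch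
      refine ⟨hcard, fun l r L R hk hL hR => ?_⟩
      have hx : 1 ≤ T.card := Finset.card_pos.2 (Finset.nonempty_iff_ne_empty.2 hne)
      rw [← isIterator_iff_iter] at hL hR
      obtain ⟨a1, a2, a3⟩ := value_lin_absorb hF hT hne h0 hn
      obtain ⟨b1, b2, b3⟩ := value_lin_absorb hF' hT' hne' h0' hn'
      -- Both productions are brought to the product of the singles of `lin μ F T`: directly on the
      -- left, through the permutation `hs` on the right.
      rw [prod_eq_of_singles_perm hB hx hk hL hR (isIterator_iff_iter.2 (iter_lin hF hh hT))
          a1 a2 a3 (.refl _),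
        prod_eq_of_singles_perm hB (hcard ▸ hx) (hcard ▸ hk) hL hR
          (isIterator_iff_iter.2 (iter_lin hF' hh' hT')) b1 b2 b3 hs]
    | leaf => simp at harch
    | nil => simp at harch
    | empty => simp at harch
    | first => simp at harch
    | last => simpa using congrArg List.getLast? harch

end Architectures

/-! ### Productions on separated sets as sums over lists -/

section Selections

/-- The lists made of one element of each of the sets of a list. -/
def selections : List (Finset ℕ) → Finset (List ℕ)
  | [] => {[]}
  | I :: Is => (I ×ˢ selections Is).map
      ⟨fun x => x.1 :: x.2, fun _ _ h => Prod.ext (List.cons.inj h).1 (List.cons.inj h).2⟩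

lemma sum_selections_cons (I : Finset ℕ) (Is : List (Finset ℕ)) (f : List ℕ → ℕ) :
    ∑ l ∈ selections (I :: Is), f l = ∑ i ∈ I, ∑ l ∈ selections Is, f (i :: l) := by
  rw [selections, Finset.sum_map, Finset.sum_product]
  rfl

lemma mem_selections {l : List ℕ} {Is : List (Finset ℕ)} :
    l ∈ selections Is ↔ List.Forall₂ (fun i I => i ∈ I) l Is := by
  induction Is generalizing l with
  | nil => simp [selections]
  | cons I Is ih => 
    simp only [selections, Finset.mem_map, Finset.mem_product, ih,
      List.forall₂_cons_right_iff, Prod.exists]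
    constructor
    · rintro ⟨a, b, ⟨h1, h2⟩, rfl⟩
      exact ⟨a, b, h1, h2, rfl⟩
    · rintro ⟨a, b, h1, h2, rfl⟩
      exact ⟨a, b, ⟨h1, h2⟩, rfl⟩

/-- The sets of a list are in decreasing order, i.e. every element of a set is greater than the
elements of the sets which follow. -/
def DecreasingSets (Is : List (Finset ℕ)) : Prop :=
  Is.Pairwise fun I J => ∀ i ∈ I, ∀ j ∈ J, j < i

lemma DecreasingSets.pairwise {Is : List (Finset ℕ)} (h : DecreasingSets Is) {l : List ℕ}
    (hl : List.Forall₂ (fun i I => i ∈ I) l Is) : l.Pairwise (· ≥ ·) := by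
  induction hl with
  | nil => exact .nil
  | @cons i I l Is hi hl ih =>
    rw [DecreasingSets, List.pairwise_cons] at h
    refine List.pairwise_cons.2 ⟨fun j hj => ?_, ih h.2⟩
    obtain ⟨J, hJ, hjJ⟩ : ∃ J ∈ Is, j ∈ J := by
      clear ih h
      induction hl with
      | nil => simp at hj
      | cons h _ ih =>
        rcases List.mem_cons.1 hj with rfl | hj
        · exact ⟨_, by simp, h⟩
        · obtain ⟨J, hJ, h⟩ := ih hj
          exact ⟨J, by simp [hJ], h⟩
    exact (h.1 J hJ i hi j hjJ).le

lemma DecreasingSets.sort_eq {Is : List (Finset ℕ)} (h : DecreasingSets Is) {l : List ℕ}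
    (hl : List.Forall₂ (fun i I => i ∈ I) l Is) : (l : Multiset ℕ).sort (· ≥ ·) = l := by
  refine List.Perm.eq_of_pairwise' (r := (· ≥ ·)) (Multiset.pairwise_sort _ _) (h.pairwise hl) ?_
  rw [← Multiset.coe_eq_coe, Multiset.sort_eq]

lemma exists_forall₂_of_rel {α β : Type*} {r : α → β → Prop} {s : Multiset α} {l : List β}
    (h : Multiset.Rel r s l) : ∃ l' : List α, (l' : Multiset α) = s ∧ List.Forall₂ r l' l := by
  induction l generalizing s with
  | nil => exact ⟨[], by simpa [eq_comm] using h, .nil⟩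
  | cons b l ih =>
    rw [← Multiset.cons_coe, Multiset.rel_cons_right] at h
    obtain ⟨a, s', hab, hs, rfl⟩ := h
    obtain ⟨l', rfl, hl⟩ := ih hs
    exact ⟨a :: l', rfl, .cons hab hl⟩

lemma rel_of_forall₂ {α β : Type*} {r : α → β → Prop} {l : List α} {l' : List β}
    (h : List.Forall₂ r l l') : Multiset.Rel r (l : Multiset α) (l' : Multiset β) := by
  induction h with
  | nil => exact .zero
  | cons h _ ih => exact .cons h ih

variable {A : Type u} {M : Type v} [Monoid M] {μ : FreeMonoid A →* M}

open Classical in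
lemma prodSets_eq_sum_image {k : ℕ} (B : MarbleBimachine A M k) (w : List A)
    (I : Multiset (Finset ℕ)) :
    B.prodSets μ w I = ∑ S ∈ (Finset.univ.image
      fun S : Sym (Fin w.length) k => (S : Multiset (Fin w.length))) with
        Multiset.Rel (fun (i : Fin w.length) J => (i : ℕ) ∈ J) S I, B.prodAt μ w (S.map Fin.val) := by
  rw [MarbleBimachine.prodSets]
  refine Finset.sum_congr ?_ fun S _ => ?_
  · ext S
    simp [eq_comm]
  · congr 1
    simp [Multiset.bind_def, Multiset.pure_def, Multiset.bind_singleton]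

/-- As the sets are separated and listed in decreasing order, a multiset with one element in each of
them is matched in only one way, and its decreasing enumeration is the selection itself. -/
theorem prodSets_eq_sum_selections {k : ℕ} (B : MarbleBimachine A M k) (w : List A)
    {Is : List (Finset ℕ)} (hIs : DecreasingSets Is) (hlt : ∀ I ∈ Is, ∀ i ∈ I, i < w.length)
    (hk : Is.length = k) :
    B.prodSets μ w Is = ∑ l ∈ selections Is, B.prodList μ w l := by
  classical
  rw [prodSets_eq_sum_image]
  refine Finset.sum_bij (fun S _ => (S.map Fin.val).sort (· ≥ ·)) ?_ ?_ ?_ ?_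
  · intro S hS
    obtain ⟨l, hl, hr⟩ := exists_forall₂_of_rel (Finset.mem_filter.1 hS).2
    have hr' : List.Forall₂ (fun i I => i ∈ I) (l.map Fin.val) Is :=
      List.forall₂_map_left_iff.2 hr
    rw [← hl, Multiset.map_coe, hIs.sort_eq hr']
    exact mem_selections.2 hr'
  · intro S _ S' _ h
    have h' := congrArg (fun l : List ℕ => (l : Multiset ℕ)) h
    simp only [Multiset.sort_eq] at h'
    exact Multiset.map_injective Fin.val_injective h'
  · intro l hl
    have hr := mem_selections.1 hl
    have hl' : ∀ i ∈ l, i < w.length := by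
      clear hl hk hIs
      induction hr with
      | nil => simp
      | cons h _ ih =>
        intro i hi
        rcases List.mem_cons.1 hi with rfl | hi
        · exact hlt _ (by simp) _ h
        · exact ih (fun I hI => hlt I (by simp [hI])) i hi
    obtain ⟨l, rfl⟩ : ∃ l' : List (Fin w.length), l'.map Fin.val = l :=
      ⟨l.pmap Fin.mk hl', by simp [List.map_pmap]⟩
    have hlen : l.length = k := by rw [← hk, ← hr.length_eq, List.length_map]
    refine ⟨(l : Multiset (Fin w.length)), ?_, ?_⟩
    · refine Finset.mem_filter.2 ⟨Finset.mem_image.2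
        ⟨⟨(l : Multiset (Fin w.length)), by simpa using hlen⟩, Finset.mem_univ _, rfl⟩, ?_⟩
      exact rel_of_forall₂ (List.forall₂_map_left_iff.1 hr)
    · exact hIs.sort_eq hr
  · intro S _
    rfl

end Selections

/-! ### Evaluation of a bimachine on a multicontext, from the right -/

section Evaluation

variable {A : Type u} {M : Type v} [Monoid M] (μ : FreeMonoid A →* M)

open Multicontext

/-- The value of `m_0 u_1 m_1 ⋯ m_{x-1} u_x`, given as the list of the `(m_{i-1}, u_i)` in reverse
order. -/
def revValue : List (M × List A) → M
  | [] => 1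
  | (m, u) :: c => revValue c * m * val μ u

/-- Production on `m_0 ⟦u_1⟧ m_1 ⋯ ⟦u_x⟧ r`, given as the list of the `(m_{i-1}, u_i)` in reverse
order, and `r`. -/
def evalRev : {k : ℕ} → MarbleBimachine A M k → List (M × List A) → M → ℕ
  | _, .base out, [(m, u)], r =>
      posSum μ u (Finset.range u.length) fun p a q => out (m * p) a (q * r)
  | _, .step _ sub out, (m, u) :: c, r =>
      posSum μ u (Finset.range u.length) fun p a q =>
        evalRev (sub (out (revValue μ c * m * p) a (q * r))) c (m * p * val μ [a])
  | _, _, _, _ => 0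

/-- The list of the `(m_{i-1}, u_i)` in reverse order, followed by `c`, and the last element `m_x` of
the multicontext `m_0 ⟦u_1⟧ m_1 ⋯ ⟦u_x⟧ m_x`. -/
def revMarks : Multicontext A M → List (M × List A) → List (M × List A) × M
  | .elem m, c => (c, m)
  | .cons m u d, c => revMarks d ((m, u) :: c)

lemma revMarks_mul_elem (d : Multicontext A M) (m : M) (c : List (M × List A)) :
    revMarks (d * .elem m) c = ((revMarks d c).1, (revMarks d c).2 * m) := by
  induction d generalizing c with
  | elem n => rfl
  | cons n u d ih => exact ih _

lemma revMarks_mul_mark (d : Multicontext A M) (u : List A) (c : List (M × List A)) :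
    revMarks (d * .mark u) c = (((revMarks d c).2, u) :: (revMarks d c).1, 1) := by
  induction d generalizing c with
  | elem n => simp [mark, elem_mul_cons, revMarks]
  | cons n u d ih => exact ih _

lemma revValue_revMarks (d : Multicontext A M) (c : List (M × List A)) :
    revValue μ (revMarks d c).1 * (revMarks d c).2 = revValue μ c * value μ d := by
  induction d generalizing c with
  | elem n => rfl
  | cons n u d ih => simp [revMarks, ih, revValue, value, mul_assoc]

/-- The word `w` and the sets `Is` of positions of `w` are a concrete form of the multicontext `d`. -/
structure Represents (w : List A) (Is : List (Finset ℕ)) (d : Multicontext A M) : Prop where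
  val_eq : val μ w = value μ d
  length_eq : Is.length = (revMarks d []).1.length
  decreasing : DecreasingSets Is
  lt_length : ∀ I ∈ Is, ∀ i ∈ I, i < w.length
  sum_eq : ∀ (k : ℕ) (B : MarbleBimachine A M k) (v : List A),
    ∑ l ∈ selections Is, B.prodList μ (w ++ v) l =
      evalRev μ B (revMarks d []).1 ((revMarks d []).2 * val μ v)

variable {μ}

lemma represents_nil : Represents μ [] [] (1 : Multicontext A M) where
  val_eq := by simp
  length_eq := rfl
  decreasing := .nil
  lt_length := by simp
  sum_eq k B v := by
    cases B <;> simp [selections, MarbleBimachine.prodList, revMarks, evalRev]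

variable {w : List A} {Is : List (Finset ℕ)} {d : Multicontext A M}

lemma Represents.append (h : Represents μ w Is d) (u : List A) :
    Represents μ (w ++ u) Is (d * .elem (val μ u)) where
  val_eq := by simp [h.val_eq]
  length_eq := by rw [revMarks_mul_elem, h.length_eq]
  decreasing := h.decreasing
  lt_length I hI i hi := by
    have := h.lt_length I hI i hi
    simp
    omega
  sum_eq k B v := by
    rw [List.append_assoc, h.sum_eq, revMarks_mul_elem, val_append, mul_assoc]

/-- The machine reads the rightmost mark first and then runs a submachine on the prefix ending
there, that is, on `w` followed by a prefix of `u`. This is why `sum_eq` is required for every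
continuation `v` and every machine. -/
lemma Represents.append_mark (h : Represents μ w Is d) {u u' : List A} {I : Finset ℕ}
    (hu : SameContexts μ u I u') :
    Represents μ (w ++ u) (I.image (w.length + ·) :: Is) (d * .mark u') where
  val_eq := by simp [h.val_eq, hu.val_eq]
  length_eq := by simp [revMarks_mul_mark, h.length_eq]
  decreasing := by
    refine List.pairwise_cons.2 ⟨fun J hJ i hi j hj => ?_, h.decreasing⟩
    obtain ⟨i, -, rfl⟩ := Finset.mem_image.1 hi
    have := h.lt_length J hJ j hj
    omega
  lt_length J hJ i hi := by
    rcases List.mem_cons.1 hJ with rfl | hJ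
    · obtain ⟨j, hj, rfl⟩ := Finset.mem_image.1 hi
      have := hu.lt_length j hj
      simp
      omega
    · have := h.lt_length J hJ i hi
      simp
      omega
  sum_eq k B v := by
    rw [revMarks_mul_mark, sum_selections_cons, Finset.sum_image (by simp)]
    have hget (i : ℕ) (hi : i < u.length) : (w ++ u ++ v)[w.length + i]? = some u[i] := by
      rw [List.append_assoc, List.getElem?_append_right (by omega),
        List.getElem?_append_left (by omega)]
      simp [hi]
    have htake (i : ℕ) (hi : i ≤ u.length) : (w ++ u ++ v).take (w.length + i) =
        w ++ u.take i := by
      rw [List.append_assoc, List.take_length_add_append, List.take_append_of_le_length hi]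
    have hdrop (i : ℕ) (hi : i < u.length) : (w ++ u ++ v).drop (w.length + i + 1) =
        u.drop (i + 1) ++ v := by
      rw [List.append_assoc, add_assoc, List.drop_length_add_append,
        List.drop_append_of_le_length hi]
    have hval := revValue_revMarks μ d []
    rw [revValue, one_mul] at hval
    have hlen := h.length_eq
    have hsum := h.sum_eq
    generalize (revMarks d []).1 = c at *
    generalize (revMarks d []).2 = m at *
    cases B with
    | base out =>
      cases c with
      | nil =>
        obtain rfl := List.length_eq_zero_iff.1 hlen
        simp only [evalRev, one_mul]
        rw [← hu.sum_eq]
        refine Finset.sum_congr rfl fun i hi => ?_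
        have hi' := hu.lt_length i hi
        rw [selections, Finset.sum_singleton, MarbleBimachine.prodList, hget i hi',
          htake i hi'.le, hdrop i hi', List.getElem?_eq_getElem hi']
        rw [revValue, one_mul] at hval
        simp [h.val_eq, ← hval]
      | cons x c =>
        obtain ⟨J, Js, rfl⟩ : ∃ J Js, Is = J :: Js := by
          cases Is with
          | nil => simp at hlen
          | cons J Js => exact ⟨J, Js, rfl⟩
        -- More marks than marbles: both sides take their default value `0`.
        have : evalRev μ (.base out) ((m, u') :: x :: c) (1 * val μ v) = 0 := by
          simp [evalRev]
        rw [this]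
        refine Finset.sum_eq_zero fun i _ => ?_
        rw [sum_selections_cons]
        refine Finset.sum_eq_zero fun j _ => Finset.sum_eq_zero fun l _ => ?_
        simp [MarbleBimachine.prodList]
    | step n sub out =>
      simp only [evalRev, one_mul]
      rw [← hu.sum_eq]
      refine Finset.sum_congr rfl fun i hi => ?_
      have hi' := hu.lt_length i hi
      have htake' := htake (i + 1) hi'
      rw [← add_assoc] at htake'
      -- The submachine's word includes the letter just read, hence the extra factor.
      have hv : val μ (u.take (i + 1)) = val μ (u.take i) * val μ [u[i]] := by
        rw [← val_append, List.take_append_getElem]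
      simp only [MarbleBimachine.prodList, hget i hi', htake i hi'.le, hdrop i hi', htake', hsum,
        List.getElem?_eq_getElem hi', Option.elim_some, val_append, hv, hval, h.val_eq, mul_assoc]

theorem Represents.prodSets_eq (h : Represents μ w Is d) {k : ℕ} (B : MarbleBimachine A M k)
    (hk : Is.length = k) :
    B.prodSets μ w Is = evalRev μ B (revMarks d []).1 (revMarks d []).2 := by
  rw [prodSets_eq_sum_selections B w h.decreasing h.lt_length hk]
  simpa using h.sum_eq k B []

end Evaluation

/-! ### From frontiers to linearizations -/

section Productions

variable {A : Type u} {M : Type v} [Monoid M] {μ : FreeMonoid A →* M}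

open Multicontext

lemma Forest.frontier_nil (F : Forest A) : F.frontier [] = F.rootFrontier := by
  cases F <;> simp [Forest.frontier]

lemma Forest.frontier_zero_cons (t : Forest A) (ts : List (Forest A)) (p : List ℕ) :
    (Forest.node (t :: ts)).frontier (0 :: p) = t.frontier p := by
  simp [Forest.frontier]

lemma Forest.frontier_shiftPath (t : Forest A) (ts : List (Forest A)) {p : List ℕ} (hp : p ≠ []) :
    (Forest.node (t :: ts)).frontier (shiftPath p) =
      ((Forest.node ts).frontier p).image (t.word.length + ·) := by
  cases p with
  | nil => exact absurd rfl hp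
  | cons j p =>
    simp only [shiftPath, Forest.frontier, List.getElem?_cons_succ]
    cases ts[j]? with
    | none => simp
    | some s => simp [Finset.image_image, Function.comp_def, add_assoc]

variable {w : List A} {Is : List (Finset ℕ)} {d : Multicontext A M}

lemma Represents.append_root (h : Represents μ w Is d) {F : Forest A} (hF : IsFactorization μ F) :
    ∃ Is', Represents μ (w ++ F.word) Is' (d * lin μ F {[]}) ∧
      (Is' : Multiset (Finset ℕ)) = (({[]} : Finset (List ℕ)).val.map fun p =>
        (F.frontier p).image (w.length + ·)) + Is := by
  refine ⟨_, lin_root μ F ▸ h.append_mark (sameContexts_rootFrontier hF), ?_⟩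
  simp [Forest.frontier_nil]

lemma Represents.append_empty (h : Represents μ w Is d) (F : Forest A) :
    ∃ Is', Represents μ (w ++ F.word) Is' (d * lin μ F ∅) ∧
      (Is' : Multiset (Finset ℕ)) = ((∅ : Finset (List ℕ)).val.map fun p =>
        (F.frontier p).image (w.length + ·)) + Is := by
  refine ⟨_, lin_empty μ F ▸ h.append F.word, ?_⟩
  simp

lemma Represents.append_forest (h : Represents μ w Is d) {F : Forest A} (hF : IsFactorization μ F)
    {T : Finset (List ℕ)} (hT : IsAntichainOfNodes F T) :
    ∃ Is', Represents μ (w ++ F.word) Is' (d * lin μ F T) ∧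
      (Is' : Multiset (Finset ℕ)) =
        (T.val.map fun p => (F.frontier p).image (w.length + ·)) + Is := by
  induction F using Forest.consInduction generalizing T w Is d with
  | leaf a =>
    by_cases hT' : T = {[]}
    · exact hT' ▸ h.append_root hF
    · exact hT.eq_empty_of_leaf hT' ▸ h.append_empty _
  | nil =>
    by_cases hT' : T = {[]}
    · exact hT' ▸ h.append_root hF
    · exact hT.eq_empty_of_nil hT' ▸ h.append_empty _
  | cons t ts iht ihts =>
    by_cases hT' : T = {[]}
    · exact hT' ▸ h.append_root hF
    have hn := hT.nil_notMem hT'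
    obtain ⟨Is₁, h₁, e₁⟩ := iht h (hF.of_mem (by simp)) hT.childNodes
    obtain ⟨Is₂, h₂, e₂⟩ := ihts h₁ (hF.of_sublist (by simp)) hT.tailNodes
    refine ⟨Is₂, ?_, ?_⟩
    · rwa [Forest.word_cons, lin_cons μ _ _ hn, ← mul_assoc, ← List.append_assoc]
    · rw [e₂, e₁, val_eq_childNodes_add_tailNodes hn, Multiset.map_add, Multiset.map_map,
        Multiset.map_map, ← add_assoc, add_comm (Multiset.map _ (tailNodes T).val)]
      congr 2
      · refine Multiset.map_congr rfl fun p _ => ?_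
        simp [Forest.frontier_zero_cons]
      · refine Multiset.map_congr rfl fun p hp => ?_
        have hp' : p ≠ [] := by
          rintro rfl
          exact hn (by simpa using hp)
        simp [Forest.frontier_shiftPath _ _ hp', Finset.image_image, Function.comp_def, add_assoc]

lemma Represents.append_multicontext (h : Represents μ w Is d) (c : Multicontext A (List A)) :
    ∃ Is', Represents μ (w ++ c.word) Is' (d * c.map (val μ)) ∧
      (Is' : Multiset (Finset ℕ)) = c.blocks w.length + Is := by
  induction c generalizing w Is d with
  | elem v => exact ⟨_, h.append v, by simp [blocks]⟩
  | cons v u c ih =>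
    have h₁ := (h.append v).append_mark (sameContexts_range u)
    obtain ⟨Is', h', e'⟩ := ih h₁
    refine ⟨Is', ?_, ?_⟩
    · rw [Multicontext.map, cons_eq (val μ v), ← mul_assoc, ← mul_assoc, Multicontext.word,
        ← List.append_assoc, ← List.append_assoc]
      exact h'
    · have hI : (Finset.range u.length).image ((w ++ v).length + ·) =
          Finset.Ico (w.length + v.length) (w.length + v.length + u.length) := by
        rw [Finset.range_eq_Ico, Finset.image_add_left_Ico, List.length_append, add_zero]
      rw [e', hI, blocks, ← Multiset.cons_coe, List.length_append, List.length_append,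
        Multiset.cons_add, Multiset.add_cons]

/-- The word with its frontiers and the word built from chosen preimages of the `m_i` both represent
the multicontext `lin μ F T`, and the production depends only on the represented multicontext. -/
theorem prodForest_eq_prod_lin {hμ : Function.Surjective μ} {k : ℕ} (B : MarbleBimachine A M k)
    {F : Forest A} (hF : IsFactorization μ F) {T : Finset (List ℕ)} (hT : Indep F T)
    (hk : T.card = k) : B.prodForest μ F T = B.prod μ hμ (lin μ F T) := by
  obtain ⟨Is, h, hIs⟩ := represents_nil.append_forest hF hT.isAntichainOfNodes
  obtain ⟨Js, h', hJs⟩ := represents_nil.append_multicontext (μ := μ)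
    ((lin μ F T).map fun m => FreeMonoid.toList (Function.surjInv hμ m))
  have hmap (c : Multicontext A M) :
      (c.map fun m => FreeMonoid.toList (Function.surjInv hμ m)).map (val μ) = c := by
    induction c with
    | elem m => simp [Multicontext.map, val, Function.surjInv_eq]
    | cons m u c ih => simp [Multicontext.map, val, Function.surjInv_eq, ih]
  rw [hmap] at h'
  rw [List.nil_append, one_mul] at h h'
  simp only [List.length_nil, zero_add, Finset.image_id', Multiset.coe_nil, add_zero] at hIs hJs
  have hlen : Is.length = k := by
    rw [← hk]
    simpa using congrArg Multiset.card hIs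
  have hlen' : Js.length = k := by rw [h'.length_eq, ← h.length_eq, hlen]
  rw [MarbleBimachine.prodForest, ← hIs, MarbleBimachine.prod, MarbleBimachine.prodFactors, ← hJs,
    h.prodSets_eq B hlen, h'.prodSets_eq B hlen']

end Productions

end MarbleArch

open MarbleArch in
theorem mainTheorem3 {A M : Type*} [Fintype A] [Monoid M] [Fintype M]
    (μ : FreeMonoid A →* M) (hμ : Function.Surjective μ)
    {k : ℕ} (B : MarbleBimachine A M k)
    (hB : IsPermutable μ hμ B (2 ^ (3 * Fintype.card M))) :
    (∀ (x l r : ℕ), l + x + r = k →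
      ∀ (w w' : List A),
      ∀ F ∈ factorizations μ (3 * Fintype.card M) w,
      ∀ F' ∈ factorizations μ (3 * Fintype.card M) w',
      ∀ T T' : Finset (List ℕ), IsIndependent F x T → IsIndependent F' x T' →
      arch μ F T = arch μ F' T' →
      ∀ L R : Multicontext A M,
      IsIterator μ l (2 ^ (3 * Fintype.card M)) L →
      IsIterator μ r (2 ^ (3 * Fintype.card M)) R →
      B.prod μ hμ (L * lin μ F T * R) = B.prod μ hμ (L * lin μ F' T' * R)) ∧
    (∀ (w w' : List A),
      ∀ F ∈ factorizations μ (3 * Fintype.card M) w,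
      ∀ F' ∈ factorizations μ (3 * Fintype.card M) w',
      ∀ T T' : Finset (List ℕ), IsIndependent F k T → IsIndependent F' k T' →
      arch μ F T = arch μ F' T' →
      B.prodForest μ F T = B.prodForest μ F' T') := by
  constructor
  · rintro x l r hk w w' F ⟨hF, -, hh⟩ F' ⟨hF', -, hh'⟩ T T' hT hT' harch L R hL hR
    exact (prod_lin_eq_of_arch_eq hB F T hF hh hT.indep F' T' hF' hh' hT'.indep harch).2 l r L R
      (by rw [hT.1, hk]) (isIterator_iff_iter.1 hL) (isIterator_iff_iter.1 hR)
  · rintro w w' F ⟨hF, -, hh⟩ F' ⟨hF', -, hh'⟩ T T' hT hT' harch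
    rw [prodForest_eq_prod_lin (hμ := hμ) B hF hT.indep hT.1,
      prodForest_eq_prod_lin (hμ := hμ) B hF' hT'.indep hT'.1]
    -- All `k` marks are in the forest, so both outer contexts are the trivial iterator `1`.
    have := (prod_lin_eq_of_arch_eq hB F T hF hh hT.indep F' T' hF' hh' hT'.indep harch).2 0 0 1 1
      (by rw [hT.1]; omega) (.elem 1) (.elem 1)
    simpa only [one_mul, mul_one] using this
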